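/- Let $E, F, G$ be (real) Banach lattices such that $G$ is Dedekind complete and has the lattice approximation property: for every $\varepsilon>0$ and every sequence $(H_k,e_k)$ of pairs consisting of a finite-dimensional vector sublattice $H_k$ of $G$ and a strong order unit $e_k$ of $H_k$ with $\|e_k\|\to 0$, there is a finite rank operator $T\colon G\to G$ with $\big\|\,|(T-\mathrm{id})|_{H_k}|(e_k)\big\|<\varepsilon$ for all $k$. For $n\ge 1$ and a Dedekind complete Banach lattice $Z$, let $\mathcal P^r(^nE;Z)$ be the space of regular $n$-homogeneous polynomials $E\to Z$ (differences of two polynomials whose symmetric $n$-linear maps are positive), ordered by $P\le Q$ iff $Q-P$ is positive, and let $\mathcal P^r_{\mathcal N}(^nE;Z)$, the space of regular nuclear $n$-homogeneous polynomials, be the image of the positive linear map $$\overline\Phi_n\colon \big(\widehat\otimes_{n,s,|\pi|}E^*\big)\,\widehat\otimes_{|\pi|}\,Z\to\mathcal P^r(^nE;Z),\qquad \overline\Phi_n\big((x^*\otimes\cdots\otimes x^*)\otimes y\big)(x)=x^*(x)^n\,y,$$ where $\widehat\otimes_{|\pi|}$ is the positive projective (Fremlin) tensor product and $\widehat\otimes_{n,s,|\pi|}$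 the $n$-fold positive projective symmetric tensor product; it carries the order of $\mathcal P^r(^nE;Z)$ and the quotient norm $\|P\|_{\mathcal N,r}=\inf\{\|w\|:\overline\Phi_n(w)=P\}$. If $E^*$ and $F^*$ are lattice isomorphic, then for every $n\ge1$ the Banach lattices $\mathcal P^r_{\mathcal N}(^nE;G)$ and $\mathcal P^r_{\mathcal N}(^nF;G)$ are lattice isomorphic, and so are $\mathcal P^r_{\mathcal N}(^nE;G^*)$ and $\mathcal P^r_{\mathcal N}(^nF;G^*)$; in both cases there is a linear bijection that preserves the order in both directions and is bounded, with bounded inverse, for the norms $\|\cdot\|_{\mathcal N,r}$. -/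

import Mathlib

set_option linter.unusedSectionVars false

noncomputable section

namespace RegularNuclear

universe u v w

/-! ## Ordered normed spaces with a Riesz norm, and their completions -/

/-- An ordered (semi)normed space whose norm satisfies
`‖u‖ = inf {‖v‖ : -v ≤ u ≤ v}`. Every normed vector lattice is an example; the norms of the
tensor products below are of this kind. -/
class RieszNormed (V : Type u) [SeminormedAddCommGroup V] [NormedSpace ℝ V] [Preorder V] : Prop
    extends IsOrderedAddMonoid V, IsOrderedModule ℝ V where
  norm_le_of_le : ∀ {u v : V}, -v ≤ u → u ≤ v → ‖u‖ ≤ ‖v‖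
  exists_dom : ∀ (u : V) (r : ℝ), ‖u‖ < r → ∃ v : V, -v ≤ u ∧ u ≤ v ∧ ‖v‖ < r

/-- Every normed vector lattice has a Riesz norm. -/
instance (priority := 50) rieszNormed_of_lattice (E : Type u) [NormedAddCommGroup E]
    [NormedSpace ℝ E] [Lattice E] [HasSolidNorm E] [IsOrderedAddMonoid E]
    [IsOrderedModule ℝ E] : RieszNormed E where
  norm_le_of_le := by
    intro u v h1 h2
    apply norm_le_norm_of_abs_le_abs
    exact (abs_le'.2 ⟨h2, neg_le.1 h1⟩).trans (le_abs_self v)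
  exists_dom u r h := ⟨|u|, neg_le.1 (neg_le_abs u), le_abs_self u, by rwa [norm_abs_eq_norm]⟩

/-- The completion of an ordered seminormed space. -/
def OrdCompletion (V : Type u) [SeminormedAddCommGroup V] : Type u := UniformSpace.Completion V

namespace OrdCompletion

section basic
variable (V : Type u) [SeminormedAddCommGroup V] [NormedSpace ℝ V]

instance : NormedAddCommGroup (OrdCompletion V) :=
  inferInstanceAs (NormedAddCommGroup (UniformSpace.Completion V))
instance : NormedSpace ℝ (OrdCompletion V) :=
  inferInstanceAs (NormedSpace ℝ (UniformSpace.Completion V))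
instance : CompleteSpace (OrdCompletion V) :=
  inferInstanceAs (CompleteSpace (UniformSpace.Completion V))

/-- The canonical map from a space into its completion. -/
def of : V →L[ℝ] OrdCompletion V := UniformSpace.Completion.toComplL

variable {V}

theorem norm_of (v : V) : ‖of V v‖ = ‖v‖ := UniformSpace.Completion.norm_coe v

theorem denseRange_of : DenseRange (of V) := UniformSpace.Completion.denseRange_coe

theorem isUniformInducing_of : IsUniformInducing (of V) :=
  UniformSpace.Completion.isUniformInducing_coe V

theorem exists_norm_sub_lt (a : OrdCompletion V) {r : ℝ} (hr : 0 < r) :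
    ∃ v : V, ‖a - of V v‖ < r := by
  obtain ⟨v, hv⟩ := denseRange_of.exists_dist_lt a hr
  exact ⟨v, by rwa [dist_eq_norm] at hv⟩

end basic

section order
variable {V : Type u} [SeminormedAddCommGroup V] [NormedSpace ℝ V] [Preorder V]

variable (V) in
/-- The positive cone of the completion: the closure of the positive cone. -/
def posCone : Set (OrdCompletion V) := closure (of V '' {v : V | 0 ≤ v})

theorem mem_posCone_iff {a : OrdCompletion V} :
    a ∈ posCone V ↔ ∀ r : ℝ, 0 < r → ∃ v : V, 0 ≤ v ∧ ‖a - of V v‖ < r := by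
  unfold posCone
  rw [Metric.mem_closure_iff]
  constructor
  · intro h r hr
    obtain ⟨_, ⟨v, hv, rfl⟩, h⟩ := h r hr
    exact ⟨v, hv, by rwa [dist_eq_norm] at h⟩
  · intro h r hr
    obtain ⟨v, hv, h⟩ := h r hr
    exact ⟨_, ⟨v, hv, rfl⟩, by rwa [dist_eq_norm]⟩

theorem of_mem_posCone {v : V} (hv : 0 ≤ v) : of V v ∈ posCone V :=
  subset_closure ⟨v, hv, rfl⟩

variable [RieszNormed V]

theorem zero_mem_posCone : (0 : OrdCompletion V) ∈ posCone V := by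
  have := of_mem_posCone (V := V) le_rfl
  rwa [map_zero] at this

theorem add_mem_posCone {a b : OrdCompletion V} (ha : a ∈ posCone V) (hb : b ∈ posCone V) :
    a + b ∈ posCone V := by
  rw [mem_posCone_iff] at *
  intro r hr
  obtain ⟨v, hv, h1⟩ := ha (r / 2) (half_pos hr)
  obtain ⟨w, hw, h2⟩ := hb (r / 2) (half_pos hr)
  refine ⟨v + w, add_nonneg hv hw, ?_⟩
  have : a + b - of V (v + w) = (a - of V v) + (b - of V w) := by rw [map_add]; abel
  rw [this]
  linarith [norm_add_le (a - of V v) (b - of V w)]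

theorem smul_mem_posCone {c : ℝ} (hc : 0 ≤ c) {a : OrdCompletion V} (ha : a ∈ posCone V) :
    c • a ∈ posCone V := by
  rw [mem_posCone_iff] at *
  intro r hr
  obtain ⟨v, hv, h1⟩ := ha (r / (c + 1)) (by positivity)
  refine ⟨c • v, smul_nonneg hc hv, ?_⟩
  rw [map_smul, ← smul_sub, norm_smul, Real.norm_of_nonneg hc]
  rw [lt_div_iff₀ (by positivity)] at h1
  nlinarith [norm_nonneg (a - of V v)]

theorem norm_le_add {a b : OrdCompletion V} (ha : a ∈ posCone V) (hb : b ∈ posCone V) :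
    ‖a‖ ≤ ‖a + b‖ := by
  rw [mem_posCone_iff] at *
  refine le_of_forall_pos_le_add fun r hr => ?_
  obtain ⟨v, hv, h1⟩ := ha (r / 3) (by positivity)
  obtain ⟨w, hw, h2⟩ := hb (r / 3) (by positivity)
  have h3 : ‖v‖ ≤ ‖v + w‖ := by
    refine RieszNormed.norm_le_of_le ?_ (le_add_of_nonneg_right hw)
    exact (neg_nonpos.2 (add_nonneg hv hw)).trans hv
  have h4 : ‖a‖ ≤ ‖a - of V v‖ + ‖v‖ := by
    rw [← norm_of v]; simpa using norm_add_le (a - of V v) (of V v)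
  have h5 : ‖v + w‖ ≤ ‖a + b‖ + (‖a - of V v‖ + ‖b - of V w‖) := by
    rw [← norm_of (v + w)]
    have : of V (v + w) = (a + b) - ((a - of V v) + (b - of V w)) := by rw [map_add]; abel
    rw [this]
    exact (norm_sub_le _ _).trans (by gcongr; exact norm_add_le _ _)
  linarith

/-- The order of the completion. -/
instance : PartialOrder (OrdCompletion V) where
  le a b := b - a ∈ posCone V
  le_refl a := by simpa using zero_mem_posCone
  le_trans a b c h1 h2 := by simpa using add_mem_posCone h2 h1
  le_antisymm a b h1 h2 := by
    have := norm_le_add h1 h2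
    simp only [sub_add_sub_cancel, sub_self, norm_zero] at this
    exact (sub_eq_zero.1 (norm_le_zero_iff.1 this)).symm

theorem le_iff {a b : OrdCompletion V} : a ≤ b ↔ b - a ∈ posCone V := Iff.rfl

theorem nonneg_iff {a : OrdCompletion V} : 0 ≤ a ↔ a ∈ posCone V := by rw [le_iff, sub_zero]

theorem of_mono {v w : V} (h : v ≤ w) : of V v ≤ of V w := by
  rw [le_iff, ← map_sub]; exact of_mem_posCone (sub_nonneg.2 h)

theorem isClosed_nonneg : IsClosed {a : OrdCompletion V | 0 ≤ a} := by
  simp only [nonneg_iff]; exact isClosed_closure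

instance : IsOrderedAddMonoid (OrdCompletion V) where
  add_le_add_left a b h c := by
    rw [le_iff] at *; simpa using h

instance : IsOrderedModule ℝ (OrdCompletion V) where
  smul_le_smul_of_nonneg_left c hc a b h := by
    rw [le_iff] at *; rw [← smul_sub]; exact smul_mem_posCone hc h
  smul_le_smul_of_nonneg_right a ha c d h := by
    rw [nonneg_iff] at ha
    rw [le_iff]
    rw [← sub_smul]; exact smul_mem_posCone (sub_nonneg.2 h) ha

theorem norm_le_of_le' {u v : OrdCompletion V} (h1 : -v ≤ u) (h2 : u ≤ v) : ‖u‖ ≤ ‖v‖ := by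
  rw [le_iff, mem_posCone_iff] at h1 h2
  refine le_of_forall_pos_le_add fun r hr => ?_
  obtain ⟨p, hp, h3⟩ := h1 (r / 2) (by positivity)
  obtain ⟨q, hq, h4⟩ := h2 (r / 2) (by positivity)
  have hn : ‖p - q‖ ≤ ‖p + q‖ := by
    apply RieszNormed.norm_le_of_le
    · rw [neg_add_rev, sub_eq_add_neg, add_comm]
      exact add_le_add_left ((neg_nonpos.2 hp).trans hp) _
    · rw [sub_eq_add_neg]
      exact add_le_add_right ((neg_nonpos.2 hq).trans hq) _
  rw [← norm_of (p - q), ← norm_of (p + q)] at hn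
  set x := u - -v - of V p with hx
  set y := v - u - of V q with hy
  have e1 : (2 : ℝ) • u = of V (p - q) + (x - y) := by
    rw [map_sub, hx, hy, two_smul]; abel
  have e2 : of V (p + q) = (2 : ℝ) • v - (x + y) := by
    rw [map_add, hx, hy, two_smul]; abel
  have n1 : 2 * ‖u‖ ≤ ‖of V (p - q)‖ + (‖x‖ + ‖y‖) := by
    have : ‖(2 : ℝ) • u‖ = 2 * ‖u‖ := by rw [norm_smul]; norm_num
    rw [← this, e1]
    exact (norm_add_le _ _).trans (by gcongr; exact norm_sub_le _ _)
  have n2 : ‖of V (p + q)‖ ≤ 2 * ‖v‖ + (‖x‖ + ‖y‖) := by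
    have : ‖(2 : ℝ) • v‖ = 2 * ‖v‖ := by rw [norm_smul]; norm_num
    rw [← this, e2]
    exact (norm_sub_le _ _).trans (by gcongr; exact norm_add_le _ _)
  linarith

theorem exists_dom' (u : OrdCompletion V) (r : ℝ) (h : ‖u‖ < r) :
    ∃ v : OrdCompletion V, -v ≤ u ∧ u ≤ v ∧ ‖v‖ < r := by
  set δ : ℝ := (r - ‖u‖) / 8 with hδ
  have hδ0 : 0 < δ := by rw [hδ]; linarith
  -- successive approximation of `u` by elements of `V`
  have step : ∀ a : {a : OrdCompletion V // True}, ∀ s : ℝ, 0 < s → ∃ v : V,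
      ‖a.1 - of V v‖ < s := fun a s hs => exists_norm_sub_lt a.1 hs
  choose f hf using step
  let s : ℕ → ℝ := fun k => δ * (1 / 2) ^ k
  have hs : ∀ k, 0 < s k := fun k => by positivity
  let R : ℕ → OrdCompletion V := fun k =>
    Nat.rec u (fun k a => a - of V (f ⟨a, trivial⟩ (s k) (hs k))) k
  let z : ℕ → V := fun k => f ⟨R k, trivial⟩ (s k) (hs k)
  have hR : ∀ k, R (k + 1) = R k - of V (z k) := fun k => rfl
  have hR0 : R 0 = u := rfl
  have hRn : ∀ k, ‖R (k + 1)‖ < s k := fun k => by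
    rw [hR]; exact hf ⟨R k, trivial⟩ (s k) (hs k)
  have hz0 : ‖z 0‖ < ‖u‖ + 2 * δ := by
    have e : of V (z 0) = R 0 - R (0 + 1) := by rw [hR 0]; abel
    rw [← norm_of, e, hR0]
    have := hRn 0
    have h0 : s 0 = δ := by simp [s]
    rw [h0] at this
    linarith [norm_sub_le u (R (0 + 1))]
  have hz : ∀ k, ‖z (k + 1)‖ < 2 * s k := fun k => by
    have e : of V (z (k + 1)) = R (k + 1) - R (k + 2) := by rw [hR (k + 1)]; abel
    rw [← norm_of, e]
    have h1 := hRn k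
    have h2 := hRn (k + 1)
    have h3 : s (k + 1) ≤ s k := by
      simp only [s, pow_succ]
      have : 0 < δ * (1 / 2) ^ k := hs k
      linarith
    linarith [norm_sub_le (R (k + 1)) (R (k + 2))]
  obtain ⟨p, hp1, hp2, hp3⟩ := RieszNormed.exists_dom (z 0) _ hz0
  choose q hq1 hq2 hq3 using fun k => RieszNormed.exists_dom (z (k + 1)) _ (hz k)
  have hsum : HasSum s (δ * 2) := (hasSum_geometric_two).mul_left δ
  have hqs : Summable fun k => of V (q k) := by
    refine Summable.of_norm_bounded (g := fun k => 2 * s k) (hsum.summable.mul_left 2) fun k => ?_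
    rw [norm_of]; exact (hq3 k).le
  have hqn : ‖∑' k, of V (q k)‖ ≤ 2 * (δ * 2) := by
    refine tsum_of_norm_bounded (hsum.mul_left 2) fun k => ?_
    rw [norm_of]; exact (hq3 k).le
  have hRt : Filter.Tendsto (fun k => R (k + 1)) Filter.atTop (nhds 0) := by
    refine squeeze_zero_norm (fun k => (hRn k).le) ?_
    exact hsum.summable.tendsto_atTop_zero
  have hpart : ∀ k, u - of V (z 0) - R (k + 1) = ∑ i ∈ Finset.range k, of V (z (i + 1)) := by
    intro k
    induction k with
    | zero => rw [hR 0, hR0]; simp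
    | succ k ih => rw [Finset.sum_range_succ, ← ih, hR (k + 1)]; abel
  have hbd : ∀ (σ : OrdCompletion V), (∀ k, 0 ≤ σ + ∑ i ∈ Finset.range k, of V (q i)) →
      0 ≤ σ + ∑' k, of V (q k) := by
    intro σ h
    refine isClosed_nonneg.mem_of_tendsto
      ((hqs.hasSum.tendsto_sum_nat).const_add σ) (Filter.Eventually.of_forall h)
  have hlim : ∀ ε : ℝ, Filter.Tendsto (fun k => ε • (u - of V (z 0) - R (k + 1)) +
      ∑ i ∈ Finset.range k, of V (q i)) Filter.atTop
      (nhds (ε • (u - of V (z 0)) + ∑' k, of V (q k))) := by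
    intro ε
    refine Filter.Tendsto.add ?_ hqs.hasSum.tendsto_sum_nat
    refine Filter.Tendsto.const_smul ?_ ε
    simpa using hRt.const_sub (u - of V (z 0))
  have hnn : ∀ ε : ℝ, (∀ i, 0 ≤ ε • of V (z (i + 1)) + of V (q i)) →
      0 ≤ ε • (u - of V (z 0)) + ∑' k, of V (q k) := by
    intro ε h
    refine isClosed_nonneg.mem_of_tendsto (hlim ε) (Filter.Eventually.of_forall fun k => ?_)
    simp only [Set.mem_ofPred_eq]
    rw [hpart, Finset.smul_sum, ← Finset.sum_add_distrib]
    exact Finset.sum_nonneg fun i _ => h i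
  refine ⟨of V p + ∑' k, of V (q k), ?_, ?_, ?_⟩
  · have h1 := hnn 1 fun i => by
      have := of_mono (hq1 i)
      rw [map_neg] at this
      rw [one_smul]
      exact neg_le_iff_add_nonneg.1 this
    have h2 : 0 ≤ of V (z 0) + of V p := by
      have := of_mono hp1
      rw [map_neg] at this
      exact neg_le_iff_add_nonneg.1 this
    rw [neg_le_iff_add_nonneg]
    have := add_nonneg h2 h1
    rw [one_smul] at this
    convert this using 1
    abel
  · have h1 := hnn (-1) fun i => by
      have := sub_nonneg.2 (of_mono (hq2 i))
      rwa [neg_one_smul, neg_add_eq_sub]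
    have h2 : 0 ≤ of V p - of V (z 0) := sub_nonneg.2 (of_mono hp2)
    rw [← sub_nonneg]
    have := add_nonneg h2 h1
    rw [neg_one_smul] at this
    convert this using 1
    abel
  · have : ‖of V p‖ < ‖u‖ + 2 * δ := by rwa [norm_of]
    have := norm_add_le (of V p) (∑' k, of V (q k))
    have : r = ‖u‖ + 8 * δ := by rw [hδ]; ring
    linarith

instance : RieszNormed (OrdCompletion V) where
  norm_le_of_le := norm_le_of_le'
  exists_dom := exists_dom'

end order

end OrdCompletion

/-! ## The dual Banach lattice -/

/-- The dual `E*` of a Banach lattice: all bounded linear functionals, with the operator norm,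
ordered by `f ≤ g` iff `f x ≤ g x` for all `x ≥ 0`. -/
def DualLattice (E : Type u) [NormedAddCommGroup E] [NormedSpace ℝ E] : Type u := E →L[ℝ] ℝ

namespace DualLattice

section basic
variable (E : Type u) [NormedAddCommGroup E] [NormedSpace ℝ E]

instance : NormedAddCommGroup (DualLattice E) := inferInstanceAs (NormedAddCommGroup (E →L[ℝ] ℝ))
instance : NormedSpace ℝ (DualLattice E) := inferInstanceAs (NormedSpace ℝ (E →L[ℝ] ℝ))
instance : CompleteSpace (DualLattice E) := inferInstanceAs (CompleteSpace (E →L[ℝ] ℝ))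
instance : FunLike (DualLattice E) E ℝ := inferInstanceAs (FunLike (E →L[ℝ] ℝ) E ℝ)
instance : ContinuousLinearMapClass (DualLattice E) ℝ E ℝ :=
  inferInstanceAs (ContinuousLinearMapClass (E →L[ℝ] ℝ) ℝ E ℝ)

variable {E}

@[ext] theorem ext {f g : DualLattice E} (h : ∀ x, f x = g x) : f = g := DFunLike.ext f g h
@[simp] theorem add_apply (f g : DualLattice E) (x : E) : (f + g) x = f x + g x := rfl
@[simp] theorem sub_apply (f g : DualLattice E) (x : E) : (f - g) x = f x - g x := rfl
@[simp] theorem neg_apply (f : DualLattice E) (x : E) : (-f) x = -f x := rfl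
@[simp] theorem zero_apply (x : E) : (0 : DualLattice E) x = 0 := rfl
@[simp] theorem smul_apply (c : ℝ) (f : DualLattice E) (x : E) : (c • f) x = c * f x := rfl
theorem le_norm (f : DualLattice E) (x : E) : |f x| ≤ ‖f‖ * ‖x‖ :=
  ContinuousLinearMap.le_opNorm (E := E) (F := ℝ) f x
theorem norm_le (f : DualLattice E) {C : ℝ} (hC : 0 ≤ C) (h : ∀ x, |f x| ≤ C * ‖x‖) : ‖f‖ ≤ C :=
  ContinuousLinearMap.opNorm_le_bound (E := E) (F := ℝ) f hC h

/-- Evaluation at a point, as a linear functional on `E*`. -/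
def eval (x : E) : DualLattice E →ₗ[ℝ] ℝ where
  toFun f := f x
  map_add' _ _ := rfl
  map_smul' _ _ := rfl

@[simp] theorem eval_apply (x : E) (f : DualLattice E) : eval x f = f x := rfl

end basic

variable {E : Type u} [NormedAddCommGroup E] [NormedSpace ℝ E] [Lattice E] [HasSolidNorm E]
  [IsOrderedAddMonoid E] [IsOrderedModule ℝ E]

theorem eq_pos_sub_neg (x : E) : x = x⁺ - x⁻ := (posPart_sub_negPart x).symm

instance : PartialOrder (DualLattice E) where
  le f g := ∀ x : E, 0 ≤ x → f x ≤ g x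
  le_refl _ _ _ := le_rfl
  le_trans _ _ _ h1 h2 x hx := (h1 x hx).trans (h2 x hx)
  le_antisymm f g h1 h2 := by
    ext x
    rw [eq_pos_sub_neg x, map_sub, map_sub,
      (h1 _ (posPart_nonneg x)).antisymm (h2 _ (posPart_nonneg x)),
      (h1 _ (negPart_nonneg x)).antisymm (h2 _ (negPart_nonneg x))]

theorem le_def {f g : DualLattice E} : f ≤ g ↔ ∀ x : E, 0 ≤ x → f x ≤ g x := Iff.rfl

instance : IsOrderedAddMonoid (DualLattice E) where
  add_le_add_left f g h k x hx := by simpa using h x hx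

instance : IsOrderedModule ℝ (DualLattice E) where
  smul_le_smul_of_nonneg_left _ hc _ _ h x hx := mul_le_mul_of_nonneg_left (h x hx) hc
  smul_le_smul_of_nonneg_right _ hf _ _ h x hx := mul_le_mul_of_nonneg_right h (hf x hx)

theorem norm_mono {x y : E} (hx : 0 ≤ x) (h : x ≤ y) : ‖x‖ ≤ ‖y‖ := by
  apply norm_le_norm_of_abs_le_abs
  rwa [abs_of_nonneg hx, abs_of_nonneg (hx.trans h)]

/-- `sup {f y : 0 ≤ y ≤ x}`, the value of `f⁺` at `x ≥ 0`. -/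
def rk (f : DualLattice E) (x : E) : ℝ := sSup (f '' Set.Icc 0 x)

theorem rk_bdd (f : DualLattice E) (x : E) : BddAbove (f '' Set.Icc 0 x) := by
  refine ⟨‖f‖ * ‖x‖, ?_⟩
  rintro _ ⟨y, ⟨h1, h2⟩, rfl⟩
  exact (le_abs_self _).trans ((f.le_norm y).trans (by gcongr; exact norm_mono h1 h2))

theorem le_rk (f : DualLattice E) {x y : E} (h1 : 0 ≤ y) (h2 : y ≤ x) : f y ≤ rk f x :=
  le_csSup (rk_bdd f x) ⟨y, ⟨h1, h2⟩, rfl⟩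

theorem rk_le (f : DualLattice E) {x : E} (hx : 0 ≤ x) {r : ℝ}
    (h : ∀ y, 0 ≤ y → y ≤ x → f y ≤ r) : rk f x ≤ r := by
  refine csSup_le ⟨_, ⟨0, ⟨le_rfl, hx⟩, rfl⟩⟩ ?_
  rintro _ ⟨y, ⟨h1, h2⟩, rfl⟩
  exact h y h1 h2

theorem rk_nonneg (f : DualLattice E) {x : E} (hx : 0 ≤ x) : 0 ≤ rk f x := by
  simpa using le_rk f le_rfl hx

theorem rk_le_norm (f : DualLattice E) {x : E} (hx : 0 ≤ x) : rk f x ≤ ‖f‖ * ‖x‖ :=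
  rk_le f hx fun y h1 h2 =>
    (le_abs_self _).trans ((f.le_norm y).trans (by gcongr; exact norm_mono h1 h2))

theorem rk_add (f : DualLattice E) {x y : E} (hx : 0 ≤ x) (hy : 0 ≤ y) :
    rk f (x + y) = rk f x + rk f y := by
  apply le_antisymm
  · refine rk_le f (add_nonneg hx hy) fun z h1 h2 => ?_
    have e : f z = f (z ⊓ x) + f (z - z ⊓ x) := by rw [← map_add]; simp
    rw [e]
    refine add_le_add (le_rk f (le_inf h1 hx) inf_le_right)
      (le_rk f (sub_nonneg.2 inf_le_left) ?_)
    rw [sub_le_comm]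
    exact le_inf (sub_le_self _ hy) (sub_le_iff_le_add.2 h2)
  · rw [← le_sub_iff_add_le]
    refine rk_le f hx fun z h1 h2 => ?_
    rw [le_sub_comm]
    refine rk_le f hy fun t h3 h4 => ?_
    rw [le_sub_iff_add_le, ← map_add]
    exact le_rk f (add_nonneg h3 h1) (by rw [add_comm x y]; exact add_le_add h4 h2)

theorem rk_smul (f : DualLattice E) {x : E} (hx : 0 ≤ x) {c : ℝ} (hc : 0 ≤ c) :
    rk f (c • x) = c * rk f x := by
  have key : ∀ (c : ℝ) (x : E), 0 < c → 0 ≤ x → rk f (c • x) ≤ c * rk f x := by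
    intro c x hc hx
    refine rk_le f (smul_nonneg hc.le hx) fun z h1 h2 => ?_
    have e : f z = c * f (c⁻¹ • z) := by rw [map_smul, smul_eq_mul]; field_simp
    rw [e]
    refine mul_le_mul_of_nonneg_left (le_rk f (smul_nonneg (inv_nonneg.2 hc.le) h1) ?_) hc.le
    have := smul_le_smul_of_nonneg_left h2 (inv_nonneg.2 hc.le)
    rwa [smul_smul, inv_mul_cancel₀ hc.ne', one_smul] at this
  rcases hc.eq_or_lt with rfl | hc
  · rw [zero_smul, zero_mul]
    refine le_antisymm (rk_le f le_rfl fun y h1 h2 => ?_) (rk_nonneg f le_rfl)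
    rw [le_antisymm h2 h1, map_zero]
  · refine le_antisymm (key c x hc hx) ?_
    have := key c⁻¹ (c • x) (inv_pos.2 hc) (smul_nonneg hc.le hx)
    rw [smul_smul, inv_mul_cancel₀ hc.ne', one_smul] at this
    calc c * rk f x ≤ c * (c⁻¹ * rk f (c • x)) := by gcongr
      _ = rk f (c • x) := by field_simp

theorem rk_eq (f : DualLattice E) {x a b : E} (ha : 0 ≤ a) (hb : 0 ≤ b) (h : x = a - b) :
    rk f x⁺ - rk f x⁻ = rk f a - rk f b := by
  have h1 : x⁺ + b = a + x⁻ := by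
    have := posPart_sub_negPart x
    rw [h] at this ⊢
    rw [sub_eq_sub_iff_add_eq_add] at this
    exact this
  have := congrArg (rk f) h1
  rw [rk_add f (posPart_nonneg x) hb, rk_add f ha (negPart_nonneg x)] at this
  linarith

/-- The positive part `f⁺` of a functional. -/
def pos (f : DualLattice E) : DualLattice E :=
  LinearMap.mkContinuous
    { toFun := fun x => rk f x⁺ - rk f x⁻
      map_add' := by
        intro x y
        have e : x + y = (x⁺ + y⁺) - (x⁻ + y⁻) := by
          conv_lhs => rw [eq_pos_sub_neg x, eq_pos_sub_neg y]
          abel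
        rw [rk_eq f (add_nonneg (posPart_nonneg x) (posPart_nonneg y))
          (add_nonneg (negPart_nonneg x) (negPart_nonneg y)) e,
          rk_add f (posPart_nonneg x) (posPart_nonneg y),
          rk_add f (negPart_nonneg x) (negPart_nonneg y)]
        ring
      map_smul' := by
        intro c x
        rw [RingHom.id_apply, smul_eq_mul]
        rcases le_total 0 c with hc | hc
        · have e : c • x = c • x⁺ - c • x⁻ := by
            rw [← smul_sub, ← eq_pos_sub_neg]
          rw [rk_eq f (smul_nonneg hc (posPart_nonneg x)) (smul_nonneg hc (negPart_nonneg x)) e,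
            rk_smul f (posPart_nonneg x) hc, rk_smul f (negPart_nonneg x) hc]
          ring
        · have hc' : 0 ≤ -c := neg_nonneg.2 hc
          have e : c • x = (-c) • x⁻ - (-c) • x⁺ := by
            rw [← smul_sub, neg_smul, ← smul_neg, neg_sub, ← eq_pos_sub_neg]
          rw [rk_eq f (smul_nonneg hc' (negPart_nonneg x)) (smul_nonneg hc' (posPart_nonneg x)) e,
            rk_smul f (posPart_nonneg x) hc', rk_smul f (negPart_nonneg x) hc']
          ring } ‖f‖ (by
      intro x
      simp only [LinearMap.coe_mk, AddHom.coe_mk, Real.norm_eq_abs]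
      have hp : ‖x⁺‖ ≤ ‖x‖ := by
        apply norm_le_norm_of_abs_le_abs
        rw [abs_of_nonneg (posPart_nonneg x), ← posPart_add_negPart x]
        exact le_add_of_nonneg_right (negPart_nonneg x)
      have hm : ‖x⁻‖ ≤ ‖x‖ := by
        apply norm_le_norm_of_abs_le_abs
        rw [abs_of_nonneg (negPart_nonneg x), ← posPart_add_negPart x]
        exact le_add_of_nonneg_left (posPart_nonneg x)
      have h1 := rk_le_norm f (posPart_nonneg x)
      have h2 := rk_le_norm f (negPart_nonneg x)
      have h3 := rk_nonneg f (posPart_nonneg x)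
      have h4 := rk_nonneg f (negPart_nonneg x)
      have h5 : ‖f‖ * ‖x⁺‖ ≤ ‖f‖ * ‖x‖ := by gcongr
      have h6 : ‖f‖ * ‖x⁻‖ ≤ ‖f‖ * ‖x‖ := by gcongr
      rw [abs_le]; constructor <;> linarith)

theorem pos_apply (f : DualLattice E) {x : E} (hx : 0 ≤ x) : pos f x = rk f x := by
  have : pos f x = rk f x⁺ - rk f x⁻ := rfl
  rw [this, rk_eq f hx le_rfl (sub_zero x).symm]
  have h0 : rk f (0 : E) = 0 := by simpa using rk_smul f (le_refl (0 : E)) le_rfl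
  rw [h0, sub_zero]

theorem pos_nonneg (f : DualLattice E) : 0 ≤ pos f := fun x hx => by
  rw [pos_apply f hx]; exact rk_nonneg f hx

theorem le_pos (f : DualLattice E) : f ≤ pos f := fun x hx => by
  rw [pos_apply f hx]; exact le_rk f hx le_rfl

theorem pos_le {f g : DualLattice E} (hg : 0 ≤ g) (h : f ≤ g) : pos f ≤ g := fun x hx => by
  rw [pos_apply f hx]
  refine rk_le f hx fun y h1 h2 => (h y h1).trans ?_
  have := hg (x - y) (sub_nonneg.2 h2)
  simp only [map_sub, zero_apply] at this
  linarith

/-- The lattice operations of `E*` are those given by the Riesz-Kantorovich formula. -/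
instance : Lattice (DualLattice E) where
  sup f g := f + pos (g - f)
  le_sup_left f g := le_add_of_nonneg_right (pos_nonneg _)
  le_sup_right f g := sub_le_iff_le_add'.1 (le_pos (g - f))
  sup_le f g k h1 h2 := by
    have := pos_le (sub_nonneg.2 h1) (sub_le_sub_right h2 f)
    exact le_sub_iff_add_le'.1 this
  inf f g := f - pos (f - g)
  inf_le_left f g := sub_le_self _ (pos_nonneg _)
  inf_le_right f g := sub_le_comm.1 (le_pos (f - g))
  le_inf f g k h1 h2 := by
    have := pos_le (sub_nonneg.2 h1) (sub_le_sub_left h2 g)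
    exact le_sub_comm.1 this

theorem abs_apply_le (f : DualLattice E) {x y : E} (h1 : -y ≤ x) (h2 : x ≤ y) :
    |f x| ≤ |f| y := by
  have a1 : 0 ≤ y - x := sub_nonneg.2 h2
  have a2 : 0 ≤ y + x := by simpa [add_comm] using sub_nonneg.2 h1
  have b1 := le_abs_self f _ a1
  have b2 := le_abs_self f _ a2
  have b3 := neg_le_abs f _ a1
  have b4 := neg_le_abs f _ a2
  simp only [map_sub, map_add, neg_apply] at b1 b2 b3 b4
  rw [abs_le]; constructor <;> linarith

theorem abs_apply_le_norm (f : DualLattice E) {x : E} (hx : 0 ≤ x) : |f| x ≤ ‖f‖ * ‖x‖ := by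
  have e : |f| = -f + pos (f - -f) := by rw [abs, sup_comm]; rfl
  rw [e, add_apply, pos_apply _ hx, neg_apply, ← le_sub_iff_add_le']
  refine rk_le _ hx fun y h1 h2 => ?_
  rw [le_sub_iff_add_le]
  have e2 : (f - -f) y + -f x = f (y + y - x) := by
    rw [sub_neg_eq_add, add_apply, map_sub, map_add]; ring
  rw [e2]
  refine (le_abs_self _).trans ((f.le_norm _).trans ?_)
  gcongr
  apply norm_le_norm_of_abs_le_abs
  rw [abs_of_nonneg hx, abs_le']
  constructor
  · exact sub_le_iff_le_add.2 (add_le_add h2 h2)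
  · rw [neg_sub]; exact sub_le_self _ (add_nonneg h1 h1)

instance : HasSolidNorm (DualLattice E) where
  solid f g h := by
    refine f.norm_le (norm_nonneg g) fun x => ?_
    have h1 := f.abs_apply_le (neg_le.1 (neg_le_abs x)) (le_abs_self x)
    have h2 := g.abs_apply_le_norm (abs_nonneg x)
    rw [norm_abs_eq_norm] at h2
    exact h1.trans ((h _ (abs_nonneg x)).trans h2)

end DualLattice
/-! ## Seminorms defined by domination -/

section domination
variable {V : Type u} [AddCommGroup V] [Module ℝ V] [Preorder V]

/-- The infimum of the costs `r` of the elements `(v, r)` of `D` with `|u| ≤ v`,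
that is, `-v ≤ u ≤ v`. -/
def domNorm (D : Set (V × ℝ)) (u : V) : ℝ := sInf {r : ℝ | ∃ v : V, (v, r) ∈ D ∧ -v ≤ u ∧ u ≤ v}

/-- The closure properties of `D` which make `domNorm D` a seminorm. -/
structure IsDominating (D : Set (V × ℝ)) : Prop where
  zero_mem : ((0 : V), (0 : ℝ)) ∈ D
  add_mem : ∀ {v w : V} {r s : ℝ}, (v, r) ∈ D → (w, s) ∈ D → (v + w, r + s) ∈ D
  smul_mem : ∀ {v : V} {r c : ℝ}, 0 < c → (v, r) ∈ D → (c • v, c * r) ∈ D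
  nonneg : ∀ {v : V} {r : ℝ}, (v, r) ∈ D → 0 ≤ r
  exists_dom : ∀ u : V, ∃ v r, (v, r) ∈ D ∧ -v ≤ u ∧ u ≤ v


variable [IsOrderedAddMonoid V] [IsOrderedModule ℝ V]

namespace IsDominating
variable {D : Set (V × ℝ)}

theorem domNorm_le (hD : IsDominating D) {u v : V} {r : ℝ} (h : (v, r) ∈ D) (h1 : -v ≤ u)
    (h2 : u ≤ v) : domNorm D u ≤ r :=
  csInf_le ⟨0, by rintro s ⟨w, hw, -⟩; exact hD.nonneg hw⟩ ⟨v, h, h1, h2⟩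

theorem le_domNorm (hD : IsDominating D) {u : V} {a : ℝ}
    (h : ∀ v r, (v, r) ∈ D → -v ≤ u → u ≤ v → a ≤ r) : a ≤ domNorm D u := by
  obtain ⟨v, r, h0, h1, h2⟩ := hD.exists_dom u
  refine le_csInf ⟨r, v, h0, h1, h2⟩ ?_
  rintro s ⟨w, hw, h3, h4⟩
  exact h w s hw h3 h4

theorem le_mul_domNorm (hD : IsDominating D) {u : V} {a C : ℝ} (hC : 0 ≤ C)
    (h : ∀ v r, (v, r) ∈ D → -v ≤ u → u ≤ v → a ≤ C * r) : a ≤ C * domNorm D u := by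
  rcases hC.eq_or_lt with rfl | hC
  · obtain ⟨v, r, h0, h1, h2⟩ := hD.exists_dom u
    simpa using h v r h0 h1 h2
  · rw [← div_le_iff₀' hC]
    exact hD.le_domNorm fun v r h0 h1 h2 => by
      rw [div_le_iff₀' hC]; exact h v r h0 h1 h2

theorem domNorm_nonneg (hD : IsDominating D) (u : V) : 0 ≤ domNorm D u :=
  hD.le_domNorm fun _ _ h _ _ => hD.nonneg h

theorem exists_lt (hD : IsDominating D) {u : V} {a : ℝ} (h : domNorm D u < a) :
    ∃ v r, (v, r) ∈ D ∧ -v ≤ u ∧ u ≤ v ∧ r < a := by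
  by_contra hc
  push Not at hc
  exact absurd (hD.le_domNorm hc) (not_le.2 h)

theorem domNorm_zero (hD : IsDominating D) : domNorm D (0 : V) = 0 :=
  le_antisymm (hD.domNorm_le hD.zero_mem (by simp) le_rfl) (hD.domNorm_nonneg 0)

theorem domNorm_add (hD : IsDominating D) (u v : V) :
    domNorm D (u + v) ≤ domNorm D u + domNorm D v := by
  refine le_of_forall_pos_le_add fun ε hε => ?_
  obtain ⟨p, r, h1, h2, h3, h4⟩ := hD.exists_lt (u := u) (lt_add_of_pos_right _ (half_pos hε))
  obtain ⟨q, s, k1, k2, k3, k4⟩ := hD.exists_lt (u := v) (lt_add_of_pos_right _ (half_pos hε))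
  have := hD.domNorm_le (hD.add_mem h1 k1) (u := u + v)
    (by rw [neg_add]; exact add_le_add h2 k2) (add_le_add h3 k3)
  linarith

theorem domNorm_neg (hD : IsDominating D) (u : V) : domNorm D (-u) = domNorm D u := by
  have key : ∀ u : V, domNorm D (-u) ≤ domNorm D u := fun u =>
    hD.le_domNorm fun v r h0 h1 h2 => hD.domNorm_le h0 (neg_le_neg_iff.2 h2) (neg_le.1 h1)
  exact le_antisymm (key u) (by simpa using key (-u))

theorem domNorm_smul_le (hD : IsDominating D) (c : ℝ) (u : V) :
    domNorm D (c • u) ≤ ‖c‖ * domNorm D u := by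
  have key : ∀ (c : ℝ) (u : V), 0 < c → domNorm D (c • u) ≤ c * domNorm D u := fun c u hc =>
    hD.le_mul_domNorm hc.le fun v r h0 h1 h2 =>
      hD.domNorm_le (hD.smul_mem hc h0)
        (by rw [← smul_neg]; exact smul_le_smul_of_nonneg_left h1 hc.le)
        (smul_le_smul_of_nonneg_left h2 hc.le)
  rcases lt_trichotomy c 0 with hc | rfl | hc
  · have := key (-c) (-u) (neg_pos.2 hc)
    rwa [neg_smul, smul_neg, neg_neg, hD.domNorm_neg, ← Real.norm_of_nonpos hc.le] at this
  · rw [zero_smul, hD.domNorm_zero, norm_zero, zero_mul]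
  · rw [Real.norm_of_nonneg hc.le]; exact key c u hc

/-- The seminorm defined by a dominating set. -/
def seminorm (hD : IsDominating D) : AddGroupSeminorm V where
  toFun := domNorm D
  map_zero' := hD.domNorm_zero
  add_le' := hD.domNorm_add
  neg' := hD.domNorm_neg

/-- A seminorm defined by domination is a Riesz norm. -/
theorem norm_le_of_le (hD : IsDominating D) {u v : V} (h1 : -v ≤ u) (h2 : u ≤ v) :
    domNorm D u ≤ domNorm D v :=
  hD.le_domNorm fun _ _ h0 _ h4 =>
    hD.domNorm_le h0 ((neg_le_neg_iff.2 h4).trans h1) (h2.trans h4)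

theorem exists_dom_lt (hD : IsDominating D) (u : V) (r : ℝ) (h : domNorm D u < r) :
    ∃ v : V, -v ≤ u ∧ u ≤ v ∧ domNorm D v < r := by
  obtain ⟨v, s, h0, h1, h2, h3⟩ := hD.exists_lt h
  refine ⟨v, h1, h2, (hD.domNorm_le h0 ?_ le_rfl).trans_lt h3⟩
  exact h1.trans h2

end IsDominating
end domination

/-! ## The positive projective tensor product of two spaces -/

section binary
variable (X : Type u) (Y : Type v)
  [NormedAddCommGroup X] [NormedSpace ℝ X] [PartialOrder X] [RieszNormed X]
  [NormedAddCommGroup Y] [NormedSpace ℝ Y] [PartialOrder Y] [RieszNormed Y]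

open scoped TensorProduct

/-- The algebraic tensor product `X ⊗ Y`. It is ordered and normed below as a subspace of the
Fremlin vector lattice tensor product of `X` and `Y`, in which it is dense for the positive
projective norm; the linear functionals on the latter that are positive are the positive
bilinear forms. -/
def AlgTensor (X : Type u) (Y : Type v) [NormedAddCommGroup X] [NormedSpace ℝ X]
    [NormedAddCommGroup Y] [NormedSpace ℝ Y] : Type (max u v) := X ⊗[ℝ] Y

namespace AlgTensor

instance : AddCommGroup (AlgTensor X Y) := inferInstanceAs (AddCommGroup (X ⊗[ℝ] Y))
instance : Module ℝ (AlgTensor X Y) := inferInstanceAs (Module ℝ (X ⊗[ℝ] Y))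

variable {X Y}

/-- The elementary tensor `x ⊗ y`. -/
def tmul (x : X) (y : Y) : AlgTensor X Y := x ⊗ₜ[ℝ] y

/-- The linear map on `X ⊗ Y` induced by a bilinear map. -/
def lift {Z : Type w} [AddCommGroup Z] [Module ℝ Z] (b : X →ₗ[ℝ] Y →ₗ[ℝ] Z) :
    AlgTensor X Y →ₗ[ℝ] Z := TensorProduct.lift b

@[simp] theorem lift_tmul {Z : Type w} [AddCommGroup Z] [Module ℝ Z]
    (b : X →ₗ[ℝ] Y →ₗ[ℝ] Z) (x : X) (y : Y) : lift b (tmul x y) = b x y :=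
  TensorProduct.lift.tmul x y

theorem smul_tmul (c : ℝ) (x : X) (y : Y) : c • tmul x y = tmul (c • x) y := rfl

theorem add_tmul (x x' : X) (y : Y) : tmul (x + x') y = tmul x y + tmul x' y :=
  TensorProduct.add_tmul x x' y

/-- The linear map `x ↦ x ⊗ y`. -/
def tmulLeft (y : Y) : X →ₗ[ℝ] AlgTensor X Y where
  toFun x := tmul x y
  map_add' x x' := add_tmul x x' y
  map_smul' _ _ := rfl

theorem zero_tmul (y : Y) : tmul (0 : X) y = 0 := map_zero (tmulLeft y)

theorem induction_on {p : AlgTensor X Y → Prop} (u : AlgTensor X Y) (h0 : p 0)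
    (h1 : ∀ x y, p (tmul x y)) (h2 : ∀ u v, p u → p v → p (u + v)) : p u :=
  TensorProduct.induction_on u h0 h1 h2

/-- A bilinear form is positive if `b x y ≥ 0` for `x, y ≥ 0`. -/
def IsPosForm (b : X →ₗ[ℝ] Y →ₗ[ℝ] ℝ) : Prop := ∀ x y, 0 ≤ x → 0 ≤ y → 0 ≤ b x y

/-- The order of `X ⊗ Y`: `u ≤ v` iff `b u ≤ b v` for every positive bilinear form `b`. -/
instance : Preorder (AlgTensor X Y) where
  le u v := ∀ b : X →ₗ[ℝ] Y →ₗ[ℝ] ℝ, IsPosForm b → lift b u ≤ lift b v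
  le_refl _ _ _ := le_rfl
  le_trans _ _ _ h1 h2 b hb := (h1 b hb).trans (h2 b hb)

theorem le_def {u v : AlgTensor X Y} :
    u ≤ v ↔ ∀ b : X →ₗ[ℝ] Y →ₗ[ℝ] ℝ, IsPosForm b → lift b u ≤ lift b v := Iff.rfl

instance : IsOrderedAddMonoid (AlgTensor X Y) where
  add_le_add_left u v h w b hb := by
    rw [map_add, map_add]; exact add_le_add_left (h b hb) _

instance : IsOrderedModule ℝ (AlgTensor X Y) where
  smul_le_smul_of_nonneg_left c hc u v h b hb := by
    rw [map_smul, map_smul]; exact smul_le_smul_of_nonneg_left (h b hb) hc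
  smul_le_smul_of_nonneg_right u hu c d h b hb := by
    have := hu b hb
    rw [map_zero] at this
    rw [map_smul, map_smul]; exact smul_le_smul_of_nonneg_right h this

/-- The finite sums `∑ xᵢ ⊗ yᵢ` with `xᵢ, yᵢ ≥ 0`, each with its cost `∑ ‖xᵢ‖ ‖yᵢ‖`. -/
def dominators (X : Type u) (Y : Type v)
    [NormedAddCommGroup X] [NormedSpace ℝ X] [PartialOrder X]
    [NormedAddCommGroup Y] [NormedSpace ℝ Y] [PartialOrder Y] : Set (AlgTensor X Y × ℝ) :=
  {p | ∃ l : List (X × Y), (∀ q ∈ l, 0 ≤ q.1 ∧ 0 ≤ q.2) ∧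
    p.1 = (l.map fun q => tmul q.1 q.2).sum ∧ p.2 = (l.map fun q => ‖q.1‖ * ‖q.2‖).sum}

theorem nonneg_of_dom {Z : Type w} [SeminormedAddCommGroup Z] [NormedSpace ℝ Z] [Preorder Z]
    [RieszNormed Z] {x p : Z} (h1 : -p ≤ x) (h2 : x ≤ p) : 0 ≤ p := by
  have hp : 0 ≤ p + p := neg_le_iff_add_nonneg.1 (h1.trans h2)
  have := smul_nonneg (show (0 : ℝ) ≤ 1 / 2 by norm_num) hp
  rwa [← two_smul ℝ, smul_smul, show (1 / 2 : ℝ) * 2 = 1 by norm_num, one_smul] at this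

theorem tmul_le {x p : X} {y q : Y} (h1 : -p ≤ x) (h2 : x ≤ p) (h3 : -q ≤ y) (h4 : y ≤ q) :
    -tmul p q ≤ tmul x y ∧ tmul x y ≤ tmul p q := by
  have a1 : 0 ≤ p - x := sub_nonneg.2 h2
  have a2 : 0 ≤ p + x := neg_le_iff_add_nonneg'.1 h1
  have a3 : 0 ≤ q - y := sub_nonneg.2 h4
  have a4 : 0 ≤ q + y := neg_le_iff_add_nonneg'.1 h3
  constructor
  all_goals
    intro b hb
    have b1 := hb _ _ a1 a3
    have b2 := hb _ _ a1 a4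
    have b3 := hb _ _ a2 a3
    have b4 := hb _ _ a2 a4
    simp only [map_add, map_sub, LinearMap.add_apply, LinearMap.sub_apply] at b1 b2 b3 b4
    simp only [map_neg, lift_tmul]
    linarith

theorem isDominating : IsDominating (dominators X Y) where
  zero_mem := ⟨[], by simp, by simp, by simp⟩
  add_mem := by
    rintro v w r s ⟨l, h1, h2, h3⟩ ⟨m, k1, k2, k3⟩
    refine ⟨l ++ m, ?_, ?_, ?_⟩
    · intro q hq
      rcases List.mem_append.1 hq with hq | hq
      exacts [h1 q hq, k1 q hq]
    · simp only at h2 k2; simp [h2, k2]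
    · simp only at h3 k3; simp [h3, k3]
  smul_mem := by
    rintro v r c hc ⟨l, h1, h2, h3⟩
    refine ⟨l.map fun q => (c • q.1, q.2), ?_, ?_, ?_⟩
    · intro q hq
      obtain ⟨p, hp, rfl⟩ := List.mem_map.1 hq
      exact ⟨smul_nonneg hc.le (h1 p hp).1, (h1 p hp).2⟩
    · simp only at h2 ⊢
      rw [h2, List.smul_sum, List.map_map, List.map_map]
      rfl
    · simp only at h3 ⊢
      rw [h3, ← List.sum_map_mul_left, List.map_map]
      congr 1
      refine List.map_congr_left fun q _ => ?_
      simp [norm_smul, abs_of_pos hc, mul_assoc]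
  nonneg := by
    rintro v r ⟨l, h1, h2, h3⟩
    simp only at h3
    rw [h3]
    refine List.sum_nonneg fun a ha => ?_
    obtain ⟨q, -, rfl⟩ := List.mem_map.1 ha
    positivity
  exists_dom := by
    intro u
    suffices h : ∃ l : List (X × Y), (∀ q ∈ l, 0 ≤ q.1 ∧ 0 ≤ q.2) ∧
        -(l.map fun q => tmul q.1 q.2).sum ≤ u ∧ u ≤ (l.map fun q => tmul q.1 q.2).sum by
      obtain ⟨l, h1, h2, h3⟩ := h
      exact ⟨_, _, ⟨l, h1, rfl, rfl⟩, h2, h3⟩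
    induction u using induction_on with
    | h0 => exact ⟨[], by simp⟩
    | h1 x y =>
      obtain ⟨p, p1, p2, -⟩ := RieszNormed.exists_dom x _ (lt_add_one _)
      obtain ⟨q, q1, q2, -⟩ := RieszNormed.exists_dom y _ (lt_add_one _)
      have hp' := nonneg_of_dom p1 p2
      have hq' := nonneg_of_dom q1 q2
      obtain ⟨t1, t2⟩ := tmul_le p1 p2 q1 q2
      exact ⟨[(p, q)], by simp [hp', hq'], by simpa using t1, by simpa using t2⟩
    | h2 u v hu hv =>
      obtain ⟨l, h1, h2, h3⟩ := hu
      obtain ⟨m, k1, k2, k3⟩ := hv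
      refine ⟨l ++ m, ?_, ?_, ?_⟩
      · intro q hq
        rcases List.mem_append.1 hq with hq | hq
        exacts [h1 q hq, k1 q hq]
      · rw [List.map_append, List.sum_append, neg_add]; exact add_le_add h2 k2
      · rw [List.map_append, List.sum_append]; exact add_le_add h3 k3

/-- The positive projective norm on `X ⊗ Y`:
`‖u‖ = inf {∑ ‖xᵢ‖ ‖yᵢ‖ : |u| ≤ ∑ xᵢ ⊗ yᵢ, xᵢ, yᵢ ≥ 0}`. -/
instance : SeminormedAddCommGroup (AlgTensor X Y) :=
  isDominating.seminorm.toSeminormedAddCommGroup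

theorem norm_def (u : AlgTensor X Y) : ‖u‖ = domNorm (dominators X Y) u := rfl

instance : NormedSpace ℝ (AlgTensor X Y) where
  norm_smul_le c u := isDominating.domNorm_smul_le c u

theorem norm_tmul_le (x : X) (y : Y) : ‖tmul x y‖ ≤ ‖x‖ * ‖y‖ := by
  refine le_mul_of_forall_lt₀ fun r hr s hs => ?_
  obtain ⟨p, p1, p2, p3⟩ := RieszNormed.exists_dom x r hr
  obtain ⟨q, q1, q2, q3⟩ := RieszNormed.exists_dom y s hs
  obtain ⟨t1, t2⟩ := tmul_le p1 p2 q1 q2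
  refine (isDominating.domNorm_le (r := ‖p‖ * ‖q‖) ⟨[(p, q)], ?_, by simp, by simp⟩ t1 t2).trans
    (mul_le_mul p3.le q3.le (norm_nonneg _) ((norm_nonneg _).trans hr.le))
  simpa using ⟨nonneg_of_dom p1 p2, nonneg_of_dom q1 q2⟩

theorem continuous_tmul_left (y : Y) : Continuous fun x : X => tmul x y :=
  AddMonoidHomClass.continuous_of_bound (tmulLeft (X := X) y) ‖y‖ fun x => by
    rw [mul_comm]; exact norm_tmul_le x y

instance : RieszNormed (AlgTensor X Y) where
  norm_le_of_le := isDominating.norm_le_of_le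
  exists_dom := isDominating.exists_dom_lt

end AlgTensor

/-- The positive projective (Fremlin) tensor product of `X` and `Y`: the completion of `X ⊗ Y`
in the positive projective norm, ordered by the closure of the positive cone. -/
abbrev PosTensor := OrdCompletion (AlgTensor X Y)

end binary

/-! ## The positive projective symmetric tensor power -/

section symmetric

open scoped TensorProduct

/-- The algebraic `n`-fold symmetric tensor power of `X`: the span of the tensors
`x ⊗ ⋯ ⊗ x` in the `n`-fold tensor power. It is ordered and normed below as a subspace of the
`n`-fold Fremlin vector lattice tensor product of `X`; it is dense, for the positive projective
symmetric norm, in the vector sublattice that it generates there. -/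
def SymAlgTensor (n : ℕ) (X : Type u) [NormedAddCommGroup X] [NormedSpace ℝ X] : Type u :=
  ↥(Submodule.span ℝ (Set.range fun x : X => PiTensorProduct.tprod ℝ fun _ : Fin n => x))

namespace SymAlgTensor

section basic
variable (n : ℕ) (X : Type u) [NormedAddCommGroup X] [NormedSpace ℝ X]

instance : AddCommGroup (SymAlgTensor n X) := inferInstanceAs (AddCommGroup
  ↥(Submodule.span ℝ (Set.range fun x : X => PiTensorProduct.tprod ℝ fun _ : Fin n => x)))
instance : Module ℝ (SymAlgTensor n X) := inferInstanceAs (Module ℝ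
  ↥(Submodule.span ℝ (Set.range fun x : X => PiTensorProduct.tprod ℝ fun _ : Fin n => x)))

/-- The inclusion of the symmetric tensors in all tensors. -/
def incl : SymAlgTensor n X →ₗ[ℝ] ⨂[ℝ] _ : Fin n, X := Submodule.subtype _

variable {X}

/-- The symmetric tensor `x ⊗ ⋯ ⊗ x`. -/
def diag (x : X) : SymAlgTensor n X := ⟨_, Submodule.subset_span ⟨x, rfl⟩⟩

variable {n}

theorem incl_diag (x : X) : incl n X (diag n x) = PiTensorProduct.tprod ℝ fun _ => x := rfl

theorem incl_injective : Function.Injective (incl n X) := Subtype.val_injective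

/-- The linear map on symmetric tensors induced by an `n`-linear map. -/
def lift {Z : Type w} [AddCommGroup Z] [Module ℝ Z]
    (T : MultilinearMap ℝ (fun _ : Fin n => X) Z) : SymAlgTensor n X →ₗ[ℝ] Z :=
  (PiTensorProduct.lift T).comp (incl n X)

@[simp] theorem lift_diag {Z : Type w} [AddCommGroup Z] [Module ℝ Z]
    (T : MultilinearMap ℝ (fun _ : Fin n => X) Z) (x : X) :
    lift T (diag n x) = T fun _ => x := by
  simp [lift, incl_diag]

theorem diag_smul (c : ℝ) (x : X) : diag n (c • x) = c ^ n • diag n x := by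
  apply incl_injective
  rw [map_smul, incl_diag, incl_diag]
  have := (PiTensorProduct.tprod ℝ (s := fun _ : Fin n => X)).map_smul_univ
    (fun _ => c) (fun _ => x)
  simpa using this

theorem induction_on {p : SymAlgTensor n X → Prop} (u : SymAlgTensor n X) (h0 : p 0)
    (h1 : ∀ x, p (diag n x)) (h2 : ∀ u v, p u → p v → p (u + v))
    (h3 : ∀ (c : ℝ) u, p u → p (c • u)) : p u := by
  obtain ⟨u, hu⟩ := u
  induction hu using Submodule.span_induction with
  | mem u hu => obtain ⟨x, rfl⟩ := hu; exact h1 x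
  | zero => exact h0
  | add u v hu hv k1 k2 => exact h2 ⟨u, hu⟩ ⟨v, hv⟩ k1 k2
  | smul c u hu k => exact h3 c ⟨u, hu⟩ k

end basic

/-- An `n`-linear map is positive if it is positive on tuples of positive elements. -/
def IsPosMulti {n : ℕ} {X : Type u} {Z : Type w} [AddCommGroup X] [Module ℝ X] [PartialOrder X]
    [AddCommGroup Z] [Module ℝ Z] [PartialOrder Z]
    (T : MultilinearMap ℝ (fun _ : Fin n => X) Z) : Prop :=
  ∀ x : Fin n → X, (∀ i, 0 ≤ x i) → 0 ≤ T x

variable {n : ℕ} {X : Type u} [NormedAddCommGroup X] [NormedSpace ℝ X] [Lattice X]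
  [HasSolidNorm X] [IsOrderedAddMonoid X] [IsOrderedModule ℝ X]

/-- The order of the symmetric tensors: `u ≤ v` iff `T u ≤ T v` for every positive
`n`-linear form `T`. -/
instance : Preorder (SymAlgTensor n X) where
  le u v := ∀ T : MultilinearMap ℝ (fun _ : Fin n => X) ℝ, IsPosMulti T → lift T u ≤ lift T v
  le_refl _ _ _ := le_rfl
  le_trans _ _ _ h1 h2 T hT := (h1 T hT).trans (h2 T hT)

theorem le_def {u v : SymAlgTensor n X} :
    u ≤ v ↔ ∀ T : MultilinearMap ℝ (fun _ : Fin n => X) ℝ, IsPosMulti T → lift T u ≤ lift T v :=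
  Iff.rfl

instance : IsOrderedAddMonoid (SymAlgTensor n X) where
  add_le_add_left u v h w T hT := by
    rw [map_add, map_add]; exact add_le_add_left (h T hT) _

instance : IsOrderedModule ℝ (SymAlgTensor n X) where
  smul_le_smul_of_nonneg_left c hc u v h T hT := by
    rw [map_smul, map_smul]; exact smul_le_smul_of_nonneg_left (h T hT) hc
  smul_le_smul_of_nonneg_right u hu c d h T hT := by
    have := hu T hT
    rw [map_zero] at this
    rw [map_smul, map_smul]; exact smul_le_smul_of_nonneg_right h this

/-- The finite sums `∑ xᵢ ⊗ ⋯ ⊗ xᵢ` with `xᵢ ≥ 0`, each with its cost `∑ ‖xᵢ‖ ^ n`. -/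
def dominators (n : ℕ) (X : Type u) [NormedAddCommGroup X] [NormedSpace ℝ X] [Lattice X] :
    Set (SymAlgTensor n X × ℝ) :=
  {p | ∃ l : List X, (∀ x ∈ l, 0 ≤ x) ∧
    p.1 = (l.map fun x => diag n x).sum ∧ p.2 = (l.map fun x => ‖x‖ ^ n).sum}

theorem abs_apply_le {T : MultilinearMap ℝ (fun _ : Fin n => X) ℝ} (hT : IsPosMulti T) (x : X) :
    |T fun _ => x| ≤ T fun _ => |x| := by
  have e1 : (fun _ : Fin n => |x|) = (fun _ => x⁺) + fun _ => x⁻ := by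
    funext i; simp [posPart_add_negPart]
  have e2 : (fun _ : Fin n => x) = (fun _ => x⁺) + fun _ => -x⁻ := by
    funext i; simp [← sub_eq_add_neg, posPart_sub_negPart]
  rw [e1, T.map_add_univ, e2, T.map_add_univ]
  refine (Finset.abs_sum_le_sum_abs _ _).trans (Finset.sum_le_sum fun s _ => ?_)
  have e3 : (s.piecewise (fun _ => x⁺) fun _ => -x⁻ : Fin n → X) =
      fun i => (if i ∈ s then (1 : ℝ) else -1) • (s.piecewise (fun _ => x⁺) fun _ => x⁻) i := by
    funext i
    by_cases hi : i ∈ s <;> simp [hi]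
  have hpos : 0 ≤ T (s.piecewise (fun _ => x⁺) fun _ => x⁻) := by
    refine hT _ fun i => ?_
    by_cases hi : i ∈ s <;> simp [hi, posPart_nonneg, negPart_nonneg]
  rw [e3, T.map_smul_univ, smul_eq_mul, abs_mul, Finset.abs_prod, abs_of_nonneg hpos]
  have : ∏ i, |if i ∈ s then (1 : ℝ) else -1| = 1 :=
    Finset.prod_eq_one fun i _ => by split_ifs <;> simp
  rw [this, one_mul]

theorem isDominating [NeZero n] : IsDominating (dominators n X) where
  zero_mem := ⟨[], by simp, by simp, by simp⟩
  add_mem := by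
    rintro v w r s ⟨l, h1, h2, h3⟩ ⟨m, k1, k2, k3⟩
    refine ⟨l ++ m, ?_, ?_, ?_⟩
    · intro q hq
      rcases List.mem_append.1 hq with hq | hq
      exacts [h1 q hq, k1 q hq]
    · simp only at h2 k2; simp [h2, k2]
    · simp only at h3 k3; simp [h3, k3]
  smul_mem := by
    rintro v r c hc ⟨l, h1, h2, h3⟩
    have hd : (c ^ (1 / (n : ℝ))) ^ n = c := by
      rw [one_div]; exact Real.rpow_inv_natCast_pow hc.le (NeZero.ne n)
    have hd0 : 0 ≤ c ^ (1 / (n : ℝ)) := Real.rpow_nonneg hc.le _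
    refine ⟨l.map fun x => c ^ (1 / (n : ℝ)) • x, ?_, ?_, ?_⟩
    · intro q hq
      obtain ⟨p, hp, rfl⟩ := List.mem_map.1 hq
      exact smul_nonneg hd0 (h1 p hp)
    · simp only at h2 ⊢
      rw [h2, List.smul_sum, List.map_map, List.map_map]
      congr 1
      refine List.map_congr_left fun q _ => ?_
      simp only [Function.comp_apply]
      rw [diag_smul, hd]
    · simp only at h3 ⊢
      rw [h3, ← List.sum_map_mul_left, List.map_map]
      congr 1
      refine List.map_congr_left fun q _ => ?_
      simp only [Function.comp_apply]
      rw [norm_smul, mul_pow, Real.norm_of_nonneg hd0, hd]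
  nonneg := by
    rintro v r ⟨l, h1, h2, h3⟩
    simp only at h3
    rw [h3]
    refine List.sum_nonneg fun a ha => ?_
    obtain ⟨q, -, rfl⟩ := List.mem_map.1 ha
    positivity
  exists_dom := by
    intro u
    suffices h : ∃ l : List X, (∀ q ∈ l, 0 ≤ q) ∧
        ∀ T : MultilinearMap ℝ (fun _ : Fin n => X) ℝ, IsPosMulti T →
          |lift T u| ≤ lift T (l.map fun x => diag n x).sum by
      obtain ⟨l, h1, h2⟩ := h
      refine ⟨_, _, ⟨l, h1, rfl, rfl⟩, fun T hT => ?_, fun T hT => ?_⟩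
      · rw [map_neg]; exact (abs_le.1 (h2 T hT)).1
      · exact (abs_le.1 (h2 T hT)).2
    induction u using induction_on with
    | h0 => exact ⟨[], by simp⟩
    | h1 x =>
      refine ⟨[|x|], by simp, fun T hT => ?_⟩
      simpa using abs_apply_le hT x
    | h2 u v hu hv =>
      obtain ⟨l, h1, h2⟩ := hu
      obtain ⟨m, k1, k2⟩ := hv
      refine ⟨l ++ m, ?_, fun T hT => ?_⟩
      · intro q hq
        rcases List.mem_append.1 hq with hq | hq
        exacts [h1 q hq, k1 q hq]
      · rw [List.map_append, List.sum_append, map_add, map_add]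
        exact (abs_add_le _ _).trans (add_le_add (h2 T hT) (k2 T hT))
    | h3 c u hu =>
      obtain ⟨l, h1, h2⟩ := hu
      have hd : (|c| ^ (1 / (n : ℝ))) ^ n = |c| := by
        rw [one_div]; exact Real.rpow_inv_natCast_pow (abs_nonneg c) (NeZero.ne n)
      have hd0 : 0 ≤ |c| ^ (1 / (n : ℝ)) := Real.rpow_nonneg (abs_nonneg c) _
      refine ⟨l.map fun x => |c| ^ (1 / (n : ℝ)) • x, ?_, fun T hT => ?_⟩
      · intro q hq
        obtain ⟨p, hp, rfl⟩ := List.mem_map.1 hq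
        exact smul_nonneg hd0 (h1 p hp)
      · have e : ((l.map fun x => |c| ^ (1 / (n : ℝ)) • x).map fun x => diag n x).sum =
            |c| • (l.map fun x => diag n x).sum := by
          rw [List.smul_sum, List.map_map, List.map_map]
          congr 1
          refine List.map_congr_left fun q _ => ?_
          simp only [Function.comp_apply]
          rw [diag_smul, hd]
        rw [e, map_smul, map_smul, smul_eq_mul, smul_eq_mul, abs_mul]
        exact mul_le_mul_of_nonneg_left (h2 T hT) (abs_nonneg c)

variable [NeZero n]

/-- The positive projective symmetric norm:
`‖u‖ = inf {∑ ‖xᵢ‖ ^ n : |u| ≤ ∑ xᵢ ⊗ ⋯ ⊗ xᵢ, xᵢ ≥ 0}`. -/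
instance : SeminormedAddCommGroup (SymAlgTensor n X) :=
  isDominating.seminorm.toSeminormedAddCommGroup

theorem norm_def (u : SymAlgTensor n X) : ‖u‖ = domNorm (dominators n X) u := rfl

instance : NormedSpace ℝ (SymAlgTensor n X) where
  norm_smul_le c u := isDominating.domNorm_smul_le c u

instance : RieszNormed (SymAlgTensor n X) where
  norm_le_of_le := isDominating.norm_le_of_le
  exists_dom := isDominating.exists_dom_lt

end SymAlgTensor

/-- The `n`-fold positive projective symmetric tensor product of a Banach lattice `X`: the
completion of the symmetric tensors in the positive projective symmetric norm, ordered by the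
closure of the positive cone. -/
abbrev SymTensor (n : ℕ) [NeZero n] (X : Type u) [NormedAddCommGroup X] [NormedSpace ℝ X]
    [Lattice X] [HasSolidNorm X] [IsOrderedAddMonoid X] [IsOrderedModule ℝ X] : Type u :=
  OrdCompletion (SymAlgTensor n X)

end symmetric

/-! ## Regular homogeneous polynomials -/

section polynomials
variable (n : ℕ) (E : Type u) (G : Type v)
  [NormedAddCommGroup E] [NormedSpace ℝ E] [Lattice E] [HasSolidNorm E] [IsOrderedAddMonoid E]
  [IsOrderedModule ℝ E]
  [NormedAddCommGroup G] [NormedSpace ℝ G] [Lattice G] [HasSolidNorm G] [IsOrderedAddMonoid G]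
  [IsOrderedModule ℝ G]

variable {n E G} in
/-- `P : E → G` is a positive `n`-homogeneous polynomial: `P x = T (x, …, x)` for a positive
symmetric `n`-linear map `T`. -/
def IsPosPoly (n : ℕ) (P : E → G) : Prop :=
  ∃ T : MultilinearMap ℝ (fun _ : Fin n => E) G,
    (∀ (σ : Equiv.Perm (Fin n)) (x : Fin n → E), T (fun i => x (σ i)) = T x) ∧
    SymAlgTensor.IsPosMulti T ∧ ∀ x, P x = T fun _ => x

variable {n E G} in
theorem IsPosPoly.zero : IsPosPoly n (0 : E → G) :=
  ⟨0, by simp, fun _ _ => le_rfl, by simp⟩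

variable {n E G} in
theorem IsPosPoly.add {P Q : E → G} (hP : IsPosPoly n P) (hQ : IsPosPoly n Q) :
    IsPosPoly n (P + Q) := by
  obtain ⟨T, h1, h2, h3⟩ := hP
  obtain ⟨S, k1, k2, k3⟩ := hQ
  exact ⟨T + S, fun σ x => by simp [h1, k1], fun x hx => add_nonneg (h2 x hx) (k2 x hx),
    fun x => by simp [h3, k3]⟩

variable {n E G} in
theorem IsPosPoly.smul {P : E → G} (hP : IsPosPoly n P) {c : ℝ} (hc : 0 ≤ c) :
    IsPosPoly n (c • P) := by
  obtain ⟨T, h1, h2, h3⟩ := hP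
  exact ⟨c • T, fun σ x => by simp [h1], fun x hx => smul_nonneg hc (h2 x hx),
    fun x => by simp [h3]⟩

variable {n E G} in
theorem IsPosPoly.eq_zero {P : E → G} (hP : IsPosPoly n P) (hN : IsPosPoly n (-P)) : P = 0 := by
  obtain ⟨T, h1, h2, h3⟩ := hP
  obtain ⟨S, k1, k2, k3⟩ := hN
  -- `P` vanishes on the positive cone
  have hz : ∀ x : E, 0 ≤ x → T (fun _ => x) = 0 := by
    intro x hx
    apply le_antisymm
    · have := k2 (fun _ => x) fun _ => hx
      rw [← k3, Pi.neg_apply, h3] at this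
      exact neg_nonneg.1 this
    · exact h2 _ fun _ => hx
  -- hence `T` vanishes on positive tuples
  have hmono : ∀ (s : Finset (Fin n)) (x y : Fin n → E), (∀ i, 0 ≤ x i) → (∀ i, 0 ≤ y i) →
      0 ≤ T (s.piecewise x y) := by
    intro s x y hx hy
    refine h2 _ fun i => ?_
    by_cases hi : i ∈ s <;> simp [hi, hx, hy]
  have hT : ∀ x : Fin n → E, (∀ i, 0 ≤ x i) → T x = 0 := by
    intro x hx
    refine le_antisymm ?_ (h2 x hx)
    have e : (fun _ : Fin n => ∑ j, x j) = x + fun i => ∑ j, x j - x i := by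
      funext i; simp
    have h := hz (∑ j, x j) (Finset.sum_nonneg fun j _ => hx j)
    rw [e, T.map_add_univ] at h
    rw [← h]
    have := Finset.single_le_sum (f := fun s : Finset (Fin n) =>
      T (s.piecewise x fun i => ∑ j, x j - x i))
      (fun s _ => hmono s _ _ hx fun i => sub_nonneg.2
        (Finset.single_le_sum (fun j _ => hx j) (Finset.mem_univ i))) (Finset.mem_univ Finset.univ)
    simpa using this
  funext x
  rw [h3, Pi.zero_apply]
  have e2 : (fun _ : Fin n => x) = (fun _ => x⁺) + fun _ => -x⁻ := by
    funext i; simp [← sub_eq_add_neg, posPart_sub_negPart]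
  rw [e2, T.map_add_univ]
  refine Finset.sum_eq_zero fun s _ => ?_
  have e3 : (s.piecewise (fun _ => x⁺) fun _ => -x⁻ : Fin n → E) =
      fun i => (if i ∈ s then (1 : ℝ) else -1) • (s.piecewise (fun _ => x⁺) fun _ => x⁻) i := by
    funext i
    by_cases hi : i ∈ s <;> simp [hi]
  rw [e3, T.map_smul_univ, hT, smul_zero]
  intro i
  by_cases hi : i ∈ s <;> simp [hi, posPart_nonneg, negPart_nonneg]

/-- The regular `n`-homogeneous polynomials: differences of two positive ones. -/
def regularPolySubmodule : Submodule ℝ (E → G) where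
  carrier := {P | ∃ P₁ P₂ : E → G, IsPosPoly n P₁ ∧ IsPosPoly n P₂ ∧ P = P₁ - P₂}
  zero_mem' := ⟨0, 0, .zero, .zero, by simp⟩
  add_mem' := by
    rintro P Q ⟨P₁, P₂, h1, h2, rfl⟩ ⟨Q₁, Q₂, k1, k2, rfl⟩
    exact ⟨P₁ + Q₁, P₂ + Q₂, h1.add k1, h2.add k2, by abel⟩
  smul_mem' := by
    rintro c P ⟨P₁, P₂, h1, h2, rfl⟩
    rcases le_total 0 c with hc | hc
    · exact ⟨c • P₁, c • P₂, h1.smul hc, h2.smul hc, smul_sub _ _ _⟩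
    · refine ⟨(-c) • P₂, (-c) • P₁, h2.smul (neg_nonneg.2 hc), h1.smul (neg_nonneg.2 hc), ?_⟩
      rw [← smul_sub, neg_smul, ← smul_neg, neg_sub]

/-- The space `P^r(ⁿE; G)` of regular `n`-homogeneous polynomials. -/
def RegularPoly : Type (max u v) := ↥(regularPolySubmodule n E G)

namespace RegularPoly

instance : AddCommGroup (RegularPoly n E G) :=
  inferInstanceAs (AddCommGroup ↥(regularPolySubmodule n E G))
instance : Module ℝ (RegularPoly n E G) :=
  inferInstanceAs (Module ℝ ↥(regularPolySubmodule n E G))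

variable {n E G}

instance : FunLike (RegularPoly n E G) E G where
  coe P := P.1
  coe_injective _ _ h := Subtype.ext h

@[ext] theorem ext {P Q : RegularPoly n E G} (h : ∀ x, P x = Q x) : P = Q := DFunLike.ext P Q h
@[simp] theorem add_apply (P Q : RegularPoly n E G) (x : E) : (P + Q) x = P x + Q x := rfl
@[simp] theorem sub_apply (P Q : RegularPoly n E G) (x : E) : (P - Q) x = P x - Q x := rfl
@[simp] theorem smul_apply (c : ℝ) (P : RegularPoly n E G) (x : E) : (c • P) x = c • P x := rfl
theorem coe_sub (P Q : RegularPoly n E G) : (⇑(P - Q) : E → G) = ⇑P - ⇑Q := rfl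

/-- The order of `P^r(ⁿE; G)`: `P ≤ Q` iff `Q - P` is a positive polynomial. -/
instance : PartialOrder (RegularPoly n E G) where
  le P Q := IsPosPoly n (⇑Q - ⇑P)
  le_refl P := by rw [sub_self]; exact .zero
  le_trans P Q R h1 h2 := by
    have := IsPosPoly.add h2 h1
    rwa [sub_add_sub_cancel] at this
  le_antisymm P Q h1 h2 := by
    have : (⇑Q - ⇑P : E → G) = 0 := h1.eq_zero (by rwa [neg_sub])
    exact (DFunLike.coe_injective (sub_eq_zero.1 this)).symm

theorem le_def {P Q : RegularPoly n E G} : P ≤ Q ↔ IsPosPoly n (⇑Q - ⇑P) := Iff.rfl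

end RegularPoly

end polynomials

/-! ## Regular nuclear polynomials -/

section nuclear

open SymAlgTensor

variable {n : ℕ} {E : Type u} {G : Type v}
  [NormedAddCommGroup E] [NormedSpace ℝ E] [Lattice E] [HasSolidNorm E] [IsOrderedAddMonoid E]
  [IsOrderedModule ℝ E]
  [NormedAddCommGroup G] [NormedSpace ℝ G] [Lattice G] [HasSolidNorm G] [IsOrderedAddMonoid G]
  [IsOrderedModule ℝ G]

/-- The `n`-linear form `(f₁, …, fₙ) ↦ f₁ (m₁) ⋯ fₙ (mₙ)` on `E*`. -/
def evalForm (m : Fin n → E) : MultilinearMap ℝ (fun _ : Fin n => DualLattice E) ℝ :=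
  (MultilinearMap.mkPiAlgebra ℝ (Fin n) ℝ).compLinearMap fun i => DualLattice.eval (m i)

theorem evalForm_apply (m : Fin n → E) (f : Fin n → DualLattice E) :
    evalForm m f = ∏ i, f i (m i) := by
  simp [evalForm]

theorem evalForm_isPos {m : Fin n → E} (hm : ∀ i, 0 ≤ m i) : IsPosMulti (evalForm m) := by
  intro f hf
  rw [evalForm_apply]
  exact Finset.prod_nonneg fun i _ => hf i _ (hm i)

theorem abs_evalForm_le (m : Fin n → E) {f : Fin n → DualLattice E} (hf : ∀ i, 0 ≤ f i) :
    |evalForm m f| ≤ evalForm (fun i => |m i|) f := by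
  rw [evalForm_apply, evalForm_apply, Finset.abs_prod]
  refine Finset.prod_le_prod (fun i _ => abs_nonneg _) fun i _ => ?_
  have h1 := hf i (|m i| - m i) (sub_nonneg.2 (le_abs_self _))
  have h2 := hf i (|m i| + m i) (by
    exact neg_le_iff_add_nonneg'.1 (neg_le.1 (neg_le_abs (m i))))
  simp only [map_sub, map_add, DualLattice.zero_apply] at h1 h2
  rw [abs_le]; constructor <;> linarith

theorem abs_lift_evalForm_le (m : Fin n → E) {u v : SymAlgTensor n (DualLattice E)}
    (h1 : -v ≤ u) (h2 : u ≤ v) :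
    |lift (evalForm m) u| ≤ lift (evalForm fun i => |m i|) v := by
  have p1 : IsPosMulti (evalForm (fun i => |m i|) + evalForm m) := fun f hf => by
    have := (abs_le.1 (abs_evalForm_le m hf)).1
    simp only [add_apply]; linarith
  have p2 : IsPosMulti (evalForm (fun i => |m i|) - evalForm m) := fun f hf => by
    have := (abs_le.1 (abs_evalForm_le m hf)).2
    simp only [sub_apply]; linarith
  have la : ∀ (S T : MultilinearMap ℝ (fun _ : Fin n => DualLattice E) ℝ)
      (w : SymAlgTensor n (DualLattice E)), lift (S + T) w = lift S w + lift T w := by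
    intro S T w; simp [lift]
  have ls : ∀ (S T : MultilinearMap ℝ (fun _ : Fin n => DualLattice E) ℝ)
      (w : SymAlgTensor n (DualLattice E)), lift (S - T) w = lift S w - lift T w := by
    intro S T w; simp [lift]
  have a1 := h1 _ p1
  have a2 := h2 _ p1
  have a3 := h1 _ p2
  have a4 := h2 _ p2
  simp only [la, ls, map_neg] at a1 a2 a3 a4
  rw [abs_le]; constructor <;> linarith

variable [NeZero n]

theorem norm_lift_evalForm_le (m : Fin n → E) (u : SymAlgTensor n (DualLattice E)) :
    ‖lift (evalForm m) u‖ ≤ (∏ i, ‖m i‖) * ‖u‖ := by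
  rw [SymAlgTensor.norm_def]
  refine isDominating.le_mul_domNorm (by positivity) fun v r h0 h1 h2 => ?_
  refine (abs_lift_evalForm_le m h1 h2).trans ?_
  obtain ⟨l, l1, l2, l3⟩ := h0
  simp only at l2 l3
  rw [l2, l3, map_list_sum, List.map_map, ← List.sum_map_mul_left]
  refine List.sum_le_sum fun f _ => ?_
  rw [Function.comp_apply, lift_diag, evalForm_apply]
  calc ∏ i, f |m i| ≤ ∏ i : Fin n, ‖m i‖ * ‖f‖ := by
        refine Finset.prod_le_prod (fun i _ => l1 f ‹_› _ (abs_nonneg _)) fun i _ => ?_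
        have := f.le_norm |m i|
        rw [norm_abs_eq_norm] at this
        rw [mul_comm]
        exact (le_abs_self _).trans this
    _ = (∏ i, ‖m i‖) * ‖f‖ ^ n := by rw [Finset.prod_mul_distrib]; simp

/-- The functional on the symmetric tensor product of `E*` with value `f₁ (m₁) ⋯ fₙ (mₙ)`,
`fᵢ = f`, at `f ⊗ ⋯ ⊗ f`. -/
def evalSym (m : Fin n → E) : SymTensor n (DualLattice E) →L[ℝ] ℝ :=
  ((lift (evalForm m)).mkContinuous (∏ i, ‖m i‖) (norm_lift_evalForm_le m)).extend
    (OrdCompletion.of _)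

theorem evalSym_of (m : Fin n → E) (u : SymAlgTensor n (DualLattice E)) :
    evalSym m (OrdCompletion.of _ u) = lift (evalForm m) u :=
  ContinuousLinearMap.extend_eq _ OrdCompletion.denseRange_of OrdCompletion.isUniformInducing_of u

theorem norm_evalSym_le (m : Fin n → E) (z : SymTensor n (DualLattice E)) :
    ‖evalSym m z‖ ≤ (∏ i, ‖m i‖) * ‖z‖ := by
  refine OrdCompletion.denseRange_of.induction_on z
    (isClosed_le (by fun_prop) (by fun_prop)) fun u => ?_
  rw [evalSym_of, OrdCompletion.norm_of]
  exact norm_lift_evalForm_le m u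

theorem abs_evalSym_le (m : Fin n → E) {z : SymTensor n (DualLattice E)} (hz : 0 ≤ z) :
    |evalSym m z| ≤ evalSym (fun i => |m i|) z := by
  rw [OrdCompletion.nonneg_iff] at hz
  have hc : IsClosed {z : SymTensor n (DualLattice E) | |evalSym m z| ≤ evalSym (fun i => |m i|) z} :=
    isClosed_le (by fun_prop) (by fun_prop)
  refine closure_minimal ?_ hc hz
  rintro _ ⟨u, hu, rfl⟩
  simp only [Set.mem_ofPred_eq] at hu ⊢
  rw [evalSym_of, evalSym_of]
  exact abs_lift_evalForm_le m ((neg_nonpos.2 hu).trans hu) le_rfl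

theorem evalSym_nonneg {m : Fin n → E} (hm : ∀ i, 0 ≤ m i) {z : SymTensor n (DualLattice E)}
    (hz : 0 ≤ z) : 0 ≤ evalSym m z := by
  have := abs_evalSym_le m hz
  rw [show (fun i => |m i|) = m from funext fun i => abs_of_nonneg (hm i)] at this
  exact (abs_nonneg _).trans this

/-- The linear map on `(⊗ E*) ⊗ G` with value `f(m₁) ⋯ f(mₙ) y` at `(f ⊗ ⋯ ⊗ f) ⊗ y`. -/
def evalAlg (m : Fin n → E) : AlgTensor (SymTensor n (DualLattice E)) G →ₗ[ℝ] G :=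
  AlgTensor.lift ((LinearMap.lsmul ℝ G).comp (evalSym m).toLinearMap)

theorem evalAlg_tmul (m : Fin n → E) (z : SymTensor n (DualLattice E)) (y : G) :
    evalAlg m (AlgTensor.tmul z y) = evalSym m z • y := by
  simp [evalAlg]

/-- The bilinear form `(z, y) ↦ z(m) g(y)`. -/
def pairForm (m : Fin n → E) (g : DualLattice G) :
    SymTensor n (DualLattice E) →ₗ[ℝ] G →ₗ[ℝ] ℝ :=
  (LinearMap.lsmul ℝ (G →ₗ[ℝ] ℝ)).flip (g : G →ₗ[ℝ] ℝ) ∘ₗ (evalSym m).toLinearMap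

theorem pairForm_apply (m : Fin n → E) (g : DualLattice G) (z : SymTensor n (DualLattice E))
    (y : G) : pairForm m g z y = evalSym m z * g y := by
  simp [pairForm]

theorem lift_pairForm (m : Fin n → E) (g : DualLattice G)
    (u : AlgTensor (SymTensor n (DualLattice E)) G) :
    AlgTensor.lift (pairForm m g) u = g (evalAlg m u) := by
  induction u using AlgTensor.induction_on with
  | h0 => simp
  | h1 z y => rw [AlgTensor.lift_tmul, pairForm_apply, evalAlg_tmul, map_smul, smul_eq_mul]
  | h2 u v hu hv => rw [map_add, map_add, map_add, hu, hv]

theorem abs_pair_le (m : Fin n → E) (g : DualLattice G)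
    {u v : AlgTensor (SymTensor n (DualLattice E)) G} (h1 : -v ≤ u) (h2 : u ≤ v) :
    |g (evalAlg m u)| ≤ |g| (evalAlg (fun i => |m i|) v) := by
  have key : ∀ (z : SymTensor n (DualLattice E)) (y : G), 0 ≤ z → 0 ≤ y →
      |pairForm m g z y| ≤ pairForm (fun i => |m i|) |g| z y := by
    intro z y hz hy
    rw [pairForm_apply, pairForm_apply, abs_mul]
    have h3 := abs_evalSym_le m hz
    refine mul_le_mul h3 (g.abs_apply_le ((neg_nonpos.2 hy).trans hy) le_rfl) (abs_nonneg _)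
      ((abs_nonneg _).trans h3)
  have p1 : AlgTensor.IsPosForm (pairForm (fun i => |m i|) |g| + pairForm m g) :=
    fun z y hz hy => by
      have := (abs_le.1 (key z y hz hy)).1
      simp only [LinearMap.add_apply]; linarith
  have p2 : AlgTensor.IsPosForm (pairForm (fun i => |m i|) |g| - pairForm m g) :=
    fun z y hz hy => by
      have := (abs_le.1 (key z y hz hy)).2
      simp only [LinearMap.sub_apply]; linarith
  have la : ∀ (S T : SymTensor n (DualLattice E) →ₗ[ℝ] G →ₗ[ℝ] ℝ)
      (w : AlgTensor (SymTensor n (DualLattice E)) G),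
      AlgTensor.lift (S + T) w = AlgTensor.lift S w + AlgTensor.lift T w := by
    intro S T w
    induction w using AlgTensor.induction_on with
    | h0 => simp
    | h1 z y => simp
    | h2 u v hu hv => simp only [map_add, hu, hv]; ring
  have ls : ∀ (S T : SymTensor n (DualLattice E) →ₗ[ℝ] G →ₗ[ℝ] ℝ)
      (w : AlgTensor (SymTensor n (DualLattice E)) G),
      AlgTensor.lift (S - T) w = AlgTensor.lift S w - AlgTensor.lift T w := by
    intro S T w
    induction w using AlgTensor.induction_on with
    | h0 => simp
    | h1 z y => simp
    | h2 u v hu hv => simp only [map_add, hu, hv]; ring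
  have a1 := h1 _ p1
  have a2 := h2 _ p1
  have a3 := h1 _ p2
  have a4 := h2 _ p2
  simp only [la, ls, map_neg, lift_pairForm] at a1 a2 a3 a4
  rw [abs_le]; constructor <;> linarith

theorem norm_evalAlg_le (m : Fin n → E) (u : AlgTensor (SymTensor n (DualLattice E)) G) :
    ‖evalAlg m u‖ ≤ (∏ i, ‖m i‖) * ‖u‖ := by
  rw [AlgTensor.norm_def]
  refine AlgTensor.isDominating.le_mul_domNorm (by positivity) fun v r h0 h1 h2 => ?_
  obtain ⟨g₀, hg₀, hg₁⟩ := exists_dual_vector'' ℝ (evalAlg m u)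
  let g : DualLattice G := g₀
  have hg : ‖g‖ ≤ 1 := hg₀
  have e : ‖evalAlg m u‖ = g (evalAlg m u) := hg₁.symm
  rw [e]
  refine (le_abs_self _).trans ((abs_pair_le m g h1 h2).trans ?_)
  obtain ⟨l, l1, l2, l3⟩ := h0
  simp only at l2 l3
  rw [← lift_pairForm, l2, l3, map_list_sum, List.map_map, ← List.sum_map_mul_left]
  refine List.sum_le_sum fun q hq => ?_
  rw [Function.comp_apply, AlgTensor.lift_tmul, pairForm_apply]
  have b1 : evalSym (fun i => |m i|) q.1 ≤ (∏ i, ‖m i‖) * ‖q.1‖ := by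
    have := norm_evalSym_le (fun i => |m i|) q.1
    simp only [norm_abs_eq_norm] at this
    exact (le_abs_self _).trans this
  have b2 : |g| q.2 ≤ ‖q.2‖ := (g.abs_apply_le_norm (l1 q hq).2).trans
    (mul_le_of_le_one_left (norm_nonneg _) hg)
  have b3 : 0 ≤ |g| q.2 := abs_nonneg g _ (l1 q hq).2
  calc _ ≤ ((∏ i, ‖m i‖) * ‖q.1‖) * ‖q.2‖ := mul_le_mul b1 b2 b3 (by positivity)
    _ = _ := by ring

theorem nonneg_of_forall_dual {a : G} (h : ∀ g : DualLattice G, 0 ≤ g → 0 ≤ g a) : 0 ≤ a := by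
  by_contra ha
  have hconv : Convex ℝ {y : G | 0 ≤ y} := by
    intro x hx y hy s t hs ht _
    exact add_nonneg (smul_nonneg hs hx) (smul_nonneg ht hy)
  have hcl : IsClosed {y : G | 0 ≤ y} := isClosed_Ici
  obtain ⟨f, s, h1, h2⟩ := geometric_hahn_banach_point_closed hconv hcl ha
  have hs : s < 0 := by simpa using h2 0 (le_refl (0 : G))
  have hf : ∀ y : G, 0 ≤ y → 0 ≤ f y := by
    intro y hy
    by_contra hneg
    rw [not_le] at hneg
    have := h2 ((s / f y) • y) (smul_nonneg (div_nonneg_of_nonpos hs.le hneg.le) hy)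
    rw [map_smul, smul_eq_mul, div_mul_cancel₀ _ hneg.ne] at this
    exact lt_irrefl _ this
  have h3 := h f hf
  have h4 : f a < 0 := h1.trans hs
  exact absurd h3 (not_le.2 h4)

theorem evalAlg_nonneg {m : Fin n → E} (hm : ∀ i, 0 ≤ m i)
    {u : AlgTensor (SymTensor n (DualLattice E)) G} (hu : 0 ≤ u) : 0 ≤ evalAlg m u := by
  refine nonneg_of_forall_dual fun g hg => ?_
  have := hu (pairForm m g) fun z y hz hy => by
    rw [pairForm_apply]; exact mul_nonneg (evalSym_nonneg hm hz) (hg y hy)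
  rwa [map_zero, lift_pairForm] at this

variable [CompleteSpace G]

/-- The continuous linear map on the tensor product of `⊗ E*` and `G` with value
`f(m₁) ⋯ f(mₙ) y` at `(f ⊗ ⋯ ⊗ f) ⊗ y`. -/
def evalTensor (m : Fin n → E) : PosTensor (SymTensor n (DualLattice E)) G →L[ℝ] G :=
  ((evalAlg m).mkContinuous (∏ i, ‖m i‖) (norm_evalAlg_le m)).extend (OrdCompletion.of _)

theorem evalTensor_of (m : Fin n → E) (u : AlgTensor (SymTensor n (DualLattice E)) G) :
    evalTensor m (OrdCompletion.of _ u) = evalAlg m u :=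
  ContinuousLinearMap.extend_eq _ OrdCompletion.denseRange_of OrdCompletion.isUniformInducing_of u

theorem evalTensor_nonneg {m : Fin n → E} (hm : ∀ i, 0 ≤ m i)
    {w : PosTensor (SymTensor n (DualLattice E)) G} (hw : 0 ≤ w) : 0 ≤ evalTensor m w := by
  rw [OrdCompletion.nonneg_iff] at hw
  have hc : IsClosed {w : PosTensor (SymTensor n (DualLattice E)) G | 0 ≤ evalTensor m w} :=
    isClosed_le (by fun_prop) (by fun_prop)
  refine closure_minimal ?_ hc hw
  rintro _ ⟨u, hu, rfl⟩
  simp only [Set.mem_ofPred_eq] at hu ⊢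
  rw [evalTensor_of]
  exact evalAlg_nonneg hm hu

/-- Two continuous linear maps on the tensor product agree if they agree on the elements
`(f ⊗ ⋯ ⊗ f) ⊗ y`. -/
theorem tensor_ext {Z : Type w} [NormedAddCommGroup Z] [NormedSpace ℝ Z]
    {A B : PosTensor (SymTensor n (DualLattice E)) G →L[ℝ] Z}
    (h : ∀ (f : DualLattice E) (y : G),
      A (OrdCompletion.of _ (AlgTensor.tmul (OrdCompletion.of _ (diag n f)) y)) =
      B (OrdCompletion.of _ (AlgTensor.tmul (OrdCompletion.of _ (diag n f)) y))) : A = B := by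
  have hA : ∀ u : AlgTensor (SymTensor n (DualLattice E)) G,
      A (OrdCompletion.of _ u) = B (OrdCompletion.of _ u) := by
    intro u
    induction u using AlgTensor.induction_on with
    | h0 => simp
    | h2 u v hu hv => simp only [map_add, hu, hv]
    | h1 z y =>
      have hc : Continuous fun z : SymTensor n (DualLattice E) =>
          OrdCompletion.of _ (AlgTensor.tmul z y) :=
        (OrdCompletion.of _).continuous.comp (AlgTensor.continuous_tmul_left y)
      refine OrdCompletion.denseRange_of.induction_on z
        (isClosed_eq (A.continuous.comp hc) (B.continuous.comp hc)) fun t => ?_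
      induction t using SymAlgTensor.induction_on with
      | h0 => simp only [map_zero, AlgTensor.zero_tmul]
      | h1 f => exact h f y
      | h2 t s ht hs => simp only [map_add, AlgTensor.add_tmul, ht, hs]
      | h3 c t ht => simp only [map_smul, ← AlgTensor.smul_tmul, ht]
  ext w
  exact OrdCompletion.denseRange_of.induction_on w
    (isClosed_eq A.continuous B.continuous) hA

theorem evalTensor_diag (m : Fin n → E) (f : DualLattice E) (y : G) :
    evalTensor m (OrdCompletion.of _ (AlgTensor.tmul (OrdCompletion.of _ (diag n f)) y)) =
      (∏ i, f (m i)) • y := by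
  rw [evalTensor_of, evalAlg_tmul, evalSym_of, lift_diag, evalForm_apply]

/-- The `n`-linear map `m ↦ w(m)` defined by an element `w` of the tensor product. -/
def nuclearMulti (w : PosTensor (SymTensor n (DualLattice E)) G) :
    MultilinearMap ℝ (fun _ : Fin n => E) G where
  toFun m := evalTensor m w
  map_update_add' m i x y := by
    rw [← add_apply]
    congr 1
    refine tensor_ext fun f z => ?_
    rw [add_apply, evalTensor_diag, evalTensor_diag, evalTensor_diag, ← add_smul]
    congr 1
    have := ((MultilinearMap.mkPiAlgebra ℝ (Fin n) ℝ).compLinearMap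
      fun _ => (f : E →ₗ[ℝ] ℝ)).map_update_add m i x y
    simpa only [MultilinearMap.compLinearMap_apply, MultilinearMap.mkPiAlgebra_apply] using! this
  map_update_smul' m i c x := by
    rw [← smul_apply]
    congr 1
    refine tensor_ext fun f z => ?_
    rw [smul_apply, evalTensor_diag, evalTensor_diag, smul_smul]
    congr 1
    have := ((MultilinearMap.mkPiAlgebra ℝ (Fin n) ℝ).compLinearMap
      fun _ => (f : E →ₗ[ℝ] ℝ)).map_update_smul m i c x
    simpa only [MultilinearMap.compLinearMap_apply, MultilinearMap.mkPiAlgebra_apply] using! this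

theorem nuclearMulti_apply (w : PosTensor (SymTensor n (DualLattice E)) G) (m : Fin n → E) :
    nuclearMulti w m = evalTensor m w := rfl

theorem nuclearMulti_symm (w : PosTensor (SymTensor n (DualLattice E)) G)
    (σ : Equiv.Perm (Fin n)) (m : Fin n → E) :
    nuclearMulti w (fun i => m (σ i)) = nuclearMulti w m := by
  rw [nuclearMulti_apply, nuclearMulti_apply]
  congr 1
  refine tensor_ext fun f z => ?_
  rw [evalTensor_diag, evalTensor_diag, Equiv.prod_comp σ fun i => f (m i)]

theorem isPosPoly_of_nonneg {w : PosTensor (SymTensor n (DualLattice E)) G} (hw : 0 ≤ w) :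
    IsPosPoly n fun x : E => evalTensor (fun _ => x) w :=
  ⟨nuclearMulti w, nuclearMulti_symm w, fun _ hm => evalTensor_nonneg hm hw, fun _ => rfl⟩

theorem mem_regularPoly (w : PosTensor (SymTensor n (DualLattice E)) G) :
    (fun x : E => evalTensor (fun _ => x) w) ∈ regularPolySubmodule n E G := by
  obtain ⟨v, h1, h2, -⟩ := RieszNormed.exists_dom w _ (lt_add_one _)
  have e : w = (1 / 2 : ℝ) • (v + w) - (1 / 2 : ℝ) • (v - w) := by
    rw [← smul_sub, add_sub_sub_cancel, ← two_smul ℝ, smul_smul]; norm_num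
  refine ⟨_, _, isPosPoly_of_nonneg (w := (1 / 2 : ℝ) • (v + w)) ?_,
    isPosPoly_of_nonneg (w := (1 / 2 : ℝ) • (v - w)) ?_, ?_⟩
  · exact smul_nonneg (by norm_num) (neg_le_iff_add_nonneg'.1 h1)
  · exact smul_nonneg (by norm_num) (sub_nonneg.2 h2)
  · funext x
    conv_lhs => rw [e]
    rw [map_sub, Pi.sub_apply]

variable (n E G) in
/-- The positive linear map from the positive projective tensor product of
the `n`-fold symmetric tensor product of `E*` and `G` into `P^r(ⁿE; G)` which sends
`(f ⊗ ⋯ ⊗ f) ⊗ y` to the polynomial `x ↦ (f x) ^ n y`. -/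
def nuclearMap : PosTensor (SymTensor n (DualLattice E)) G →ₗ[ℝ] RegularPoly n E G where
  toFun w := ⟨fun x => evalTensor (fun _ => x) w, mem_regularPoly w⟩
  map_add' v w := by ext x; exact map_add (evalTensor fun _ => x) v w
  map_smul' c w := by ext x; exact map_smul (evalTensor fun _ => x) c w

theorem nuclearMap_apply (w : PosTensor (SymTensor n (DualLattice E)) G) (x : E) :
    nuclearMap n E G w x = evalTensor (fun _ => x) w := rfl

/-- The defining formula of `nuclearMap`. -/
theorem nuclearMap_tmul (f : DualLattice E) (y : G) (x : E) :
    nuclearMap n E G (OrdCompletion.of _ (AlgTensor.tmul (OrdCompletion.of _ (diag n f)) y)) x =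
      (f x) ^ n • y := by
  rw [nuclearMap_apply, evalTensor_diag]; simp

/-- `nuclearMap` is positive. -/
theorem nuclearMap_nonneg {w : PosTensor (SymTensor n (DualLattice E)) G} (hw : 0 ≤ w) :
    0 ≤ nuclearMap n E G w := by
  rw [RegularPoly.le_def]
  have : (⇑(nuclearMap n E G w) - ⇑(0 : RegularPoly n E G) : E → G) =
      fun x => evalTensor (fun _ => x) w := by
    funext x; exact sub_zero _
  rw [this]
  exact isPosPoly_of_nonneg hw

variable (n E G) in
/-- The space of regular nuclear `n`-homogeneous polynomials, the range of `nuclearMap`,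
with the order of `P^r(ⁿE; G)`. -/
def NuclearPoly : Submodule ℝ (RegularPoly n E G) := LinearMap.range (nuclearMap n E G)

/-- The regular nuclear norm: the quotient norm defined by `nuclearMap`. -/
def nuclearNorm (P : NuclearPoly n E G) : ℝ :=
  sInf {r : ℝ | ∃ w, nuclearMap n E G w = P ∧ r = ‖w‖}

end nuclear

/-! ## Lattice isomorphisms, Dedekind completeness, the lattice approximation property -/

/-- A linear bijection between vector lattices is a lattice isomorphism if it and its inverse
preserve the order; it then preserves all existing suprema and infima. -/
def IsLatticeIso {A : Type u} {B : Type v} [AddCommGroup A] [Module ℝ A] [PartialOrder A]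
    [AddCommGroup B] [Module ℝ B] [PartialOrder B] (φ : A ≃ₗ[ℝ] B) : Prop :=
  ∀ a b, φ a ≤ φ b ↔ a ≤ b

/-- Every nonempty set that is bounded above has a least upper bound. -/
def DedekindComplete (G : Type u) [PartialOrder G] : Prop :=
  ∀ s : Set G, s.Nonempty → BddAbove s → ∃ a, IsLUB s a

section LAP
variable {G : Type u} [NormedAddCommGroup G] [NormedSpace ℝ G] [Lattice G]

/-- A principal pair `(H, e)` of `G`: `H` is a finite-dimensional vector sublattice of `G` and
`e ∈ H` is a strong order unit of `H`. -/
structure IsPrincipalPair (H : Submodule ℝ G) (e : G) : Prop where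
  finiteDimensional : FiniteDimensional ℝ H
  sup_mem : ∀ x ∈ H, ∀ y ∈ H, x ⊔ y ∈ H
  mem : e ∈ H
  unit : ∀ y ∈ H, ∃ c : ℝ, 0 < c ∧ |y| ≤ c • e

/-- The order of linear operators `H → G`: `S ≤ T` iff `S y ≤ T y` for all `0 ≤ y ∈ H`. -/
def OpLE {H : Submodule ℝ G} (S T : H →ₗ[ℝ] G) : Prop := ∀ y : H, 0 ≤ (y : G) → S y ≤ T y

/-- `M` is the modulus `|S|` of the operator `S`, the least upper bound of `S` and `-S`. -/
def IsModulus {H : Submodule ℝ G} (S M : H →ₗ[ℝ] G) : Prop :=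
  OpLE S M ∧ OpLE (-S) M ∧ ∀ N : H →ₗ[ℝ] G, OpLE S N → OpLE (-S) N → OpLE M N

/-- The lattice approximation property: for every `ε > 0` and every sequence `(Hₖ, eₖ)` of
principal pairs with `‖eₖ‖ → 0` there is a finite rank operator `T` on `G` such that
`‖ |(T - id)|_{Hₖ}| (eₖ) ‖ < ε` for all `k`. -/
def HasLAP (G : Type u) [NormedAddCommGroup G] [NormedSpace ℝ G] [Lattice G] : Prop :=
  ∀ ε : ℝ, 0 < ε → ∀ (H : ℕ → Submodule ℝ G) (e : ∀ k, H k),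
    (∀ k, IsPrincipalPair (H k) (e k : G)) →
    Filter.Tendsto (fun k => ‖(e k : G)‖) Filter.atTop (nhds 0) →
    ∃ T : G →L[ℝ] G, FiniteDimensional ℝ (LinearMap.range T.toLinearMap) ∧
      ∀ k, ∃ M : H k →ₗ[ℝ] G,
        IsModulus ((T.toLinearMap - LinearMap.id).comp (H k).subtype) M ∧ ‖M (e k)‖ < ε

end LAP

end RegularNuclear

end

open RegularNuclear

/-! A lattice isomorphism `φ : E* → F*` and its inverse are positive, hence bounded. They induce
mutually inverse bounded maps `S` and `R` between `(⊗ E*) ⊗ G` and `(⊗ F*) ⊗ G`, where `S` sends `(f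
⊗ ⋯ ⊗ f) ⊗ y` to `(φ f ⊗ ⋯ ⊗ φ f) ⊗ y`. The spaces of nuclear polynomials are the images of these
tensor products under `nuclearMap`. So everything reduces to one equivalence: the polynomial of `S
w` is positive exactly when the polynomial of `w` is. Applied to `w` and `-w`, it shows that `S`
matches the two kernels, so `S` descends to a linear bijection of the images. Applied to
differences, it gives the order in both directions. The norms are infima over representatives, so
they are compared through `‖S‖` and `‖R‖`.

The difficulty is that a positive polynomial need not be known to come from a positive tensor, so
positivity of `S` as a map of tensors does not settle the equivalence. By polarization
(`eq_zero_of_diagonal_eq_zero`, `nuclearMap_nonneg_iff`), positivity of the polynomial means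
positivity of the `n`-linear map defined by `w`. The `n`-linear map of `S w` at `m₁, …, mₙ` in `F`
is the extension of the `n`-linear map of `w` to `E**`, evaluated at the functionals `f ↦ (φ f)(mᵢ)`
(`evalTensor_tensorMap`). These are positive elements of `E**` when the `mᵢ` are positive, but need
not lie in `E`.

It remains to see that the extension to `E**` stays positive (`evalTensor_bidualTensor_nonneg`). Fix
all variables but one and compose with a functional on `G`: the resulting functional on `E**` is
evaluation at some `f` in `E*` (`exists_eval_bidualTensor`). This is clear for elementary tensors
and passes to limits because `E*` is closed in `E***`. If the functional is nonnegative at positive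
points of `E`, then `f ≥ 0`, so it is nonnegative at positive points of `E**`. Thus the variables
can be moved from `E` to `E**` one at a time. -/

noncomputable section

namespace RegularNuclear

universe u v w

/-! ### Polarization of symmetric multilinear maps. -/

section polarization
variable {n : ℕ} {X : Type u} {Z : Type v} [AddCommGroup X] [Module ℝ X] [AddCommGroup Z]
  [Module ℝ Z]

/-- If `r` misses `j`, adding or removing `j` does not affect whether `s` contains the range of `r`,
but flips the sign, so the terms cancel in pairs. These sums are the coefficients in the
polarization identity below. -/
theorem sum_neg_one_pow_card_of_not_surjective {r : Fin n → Fin n}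
    (hr : ¬ Function.Surjective r) :
    ∑ s : Finset (Fin n), (if ∀ i, r i ∈ s then (-1 : ℝ) ^ s.card else 0) = 0 := by
  obtain ⟨j, hj⟩ := not_forall.1 hr
  push Not at hj
  refine Finset.sum_involution (fun s _ => if j ∈ s then s.erase j else insert j s) ?_ ?_ ?_ ?_
  · intro s _
    have hiff : (∀ i, r i ∈ (if j ∈ s then s.erase j else insert j s)) ↔ ∀ i, r i ∈ s := by
      refine forall_congr' fun i => ?_
      split_ifs <;> simp [hj i]
    simp only [hiff]
    split_ifs with h1 h2
    · obtain ⟨k, hk⟩ : ∃ k, s.card = k + 1 :=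
        ⟨s.card - 1, (Nat.succ_pred_eq_of_pos (Finset.card_pos.2 ⟨j, h2⟩)).symm⟩
      rw [Finset.card_erase_of_mem h2, hk]
      simp [pow_succ]
    · rw [Finset.card_insert_of_notMem h2]
      simp [pow_succ]
    · simp
  · intro s _ _ h
    split_ifs at h with h2
    · exact (Finset.erase_eq_self.1 h) h2
    · exact h2 (Finset.insert_eq_self.1 h)
  · intro s _
    exact Finset.mem_univ _
  · intro s _
    by_cases h : j ∈ s <;> simp [h]

/-- A symmetric multilinear map is determined by its restriction to the diagonal. -/
theorem eq_zero_of_diagonal_eq_zero {D : MultilinearMap ℝ (fun _ : Fin n => X) Z}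
    (hD : ∀ (σ : Equiv.Perm (Fin n)) (x : Fin n → X), D (fun i => x (σ i)) = D x)
    (h0 : ∀ x, D (fun _ => x) = 0) (x : Fin n → X) : D x = 0 := by
  classical
  -- Alternating sum over `s` of the values of `D` at the diagonal points `∑ j ∈ s, x j`, all zero,
  -- expanded by multilinearity and regrouped by index maps `r`.
  have key : ∑ r : Fin n → Fin n, (∑ s : Finset (Fin n),
      (if ∀ i, r i ∈ s then (-1 : ℝ) ^ s.card else 0)) • D (fun i => x (r i)) = 0 := by
    simp_rw [Finset.sum_smul]
    rw [Finset.sum_comm]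
    refine Finset.sum_eq_zero fun s _ => ?_
    have h1 := D.map_sum_finset (fun _ j => x j) (fun _ => s)
    rw [h0] at h1
    have h2 := congrArg (fun z => (-1 : ℝ) ^ s.card • z) h1
    simp only [Finset.smul_sum] at h2
    rw [smul_zero] at h2
    rw [h2]
    symm
    -- The expansion involves only the `r` with values in `s`; the indicator extends it by zero to
    -- all `r`.
    refine Finset.sum_subset_zero_on_sdiff (Finset.subset_univ _) ?_ ?_
    · intro r hr
      rw [Finset.mem_sdiff, Fintype.mem_piFinset] at hr
      rw [if_neg hr.2, zero_smul]
    · intro r hr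
      rw [Fintype.mem_piFinset] at hr
      rw [if_pos hr]
  -- Only surjective `r` survive. Such an `r` is a permutation, which symmetry of `D` absorbs, and
  -- only `s = univ` contains its range.
  have h2 : ∀ r : Fin n → Fin n, (∑ s : Finset (Fin n),
      (if ∀ i, r i ∈ s then (-1 : ℝ) ^ s.card else 0)) • D (fun i => x (r i)) =
      if Function.Surjective r then (-1 : ℝ) ^ n • D x else 0 := by
    intro r
    split_ifs with hr
    · have h3 : D (fun i => x (r i)) = D x :=
        hD (Equiv.ofBijective r (Finite.injective_iff_bijective.1
          (Finite.injective_iff_surjective.2 hr))) x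
      rw [h3]
      congr 1
      rw [Finset.sum_eq_single Finset.univ]
      · simp
      · intro s _ hs
        rw [if_neg]
        intro h
        exact hs (Finset.eq_univ_of_forall fun j => by obtain ⟨i, rfl⟩ := hr j; exact h i)
      · simp
    · rw [sum_neg_one_pow_card_of_not_surjective hr, zero_smul]
  simp_rw [h2] at key
  rw [← Finset.sum_filter, Finset.sum_const, ← Nat.cast_smul_eq_nsmul ℝ, smul_smul] at key
  -- The scalar is `(-1) ^ n` times the number of surjections. That number need not be computed: the
  -- identity shows it is not zero.
  refine (smul_eq_zero.1 key).resolve_left (mul_ne_zero ?_ (by simp))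
  rw [Nat.cast_ne_zero, Finset.card_ne_zero]
  exact ⟨id, by simpa using Function.surjective_id⟩

end polarization

/-! ### Automatic continuity of positive maps. -/

section positive
variable {X : Type u} {Y : Type v}
  [NormedAddCommGroup X] [NormedSpace ℝ X] [Lattice X] [HasSolidNorm X] [IsOrderedAddMonoid X]
  [IsOrderedModule ℝ X] [CompleteSpace X]
  [NormedAddCommGroup Y] [NormedSpace ℝ Y] [Lattice Y] [HasSolidNorm Y] [IsOrderedAddMonoid Y]
  [IsOrderedModule ℝ Y]

/-- A positive linear map on a Banach lattice is bounded. -/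
theorem exists_bound_of_positive (φ : X →ₗ[ℝ] Y) (hφ : ∀ x, 0 ≤ x → 0 ≤ φ x) :
    ∃ C : ℝ, ∀ x, ‖φ x‖ ≤ C * ‖x‖ := by
  have hmono : ∀ {x y}, x ≤ y → φ x ≤ φ y := fun {x y} h => by
    have := hφ _ (sub_nonneg.2 h)
    rwa [map_sub, sub_nonneg] at this
  have habs : ∀ x, ‖φ x‖ ≤ ‖φ |x|‖ := fun x => by
    refine RieszNormed.norm_le_of_le ?_ (hmono (le_abs_self x))
    rw [← map_neg]
    exact hmono (neg_le.1 (neg_le_abs x))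
  by_contra! hc
  choose x hx using fun k : ℕ => hc (4 ^ k)
  have hx0 : ∀ k, 0 < ‖x k‖ := fun k => by
    rw [norm_pos_iff]
    rintro h
    have := hx k
    simp [h] at this
  -- Normalized so that `‖y k‖ = 2⁻ᵏ`, which is summable, while `‖φ (y k)‖ ≥ 4ᵏ / 2ᵏ = 2ᵏ`. The sum
  -- of the series dominates every `y k`, so the norm of its image exceeds every power of two.
  let y : ℕ → X := fun k => ((2 : ℝ) ^ k * ‖x k‖)⁻¹ • |x k|
  have hc0 : ∀ k, (0 : ℝ) ≤ ((2 : ℝ) ^ k * ‖x k‖)⁻¹ := fun k => by positivity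
  have hy0 : ∀ k, 0 ≤ y k := fun k => smul_nonneg (hc0 k) (abs_nonneg _)
  have hyn : ∀ k, ‖y k‖ = (1 / 2 : ℝ) ^ k := fun k => by
    have := (hx0 k).ne'
    rw [norm_smul, norm_abs_eq_norm, Real.norm_of_nonneg (hc0 k)]
    field_simp
    rw [← mul_pow]
    norm_num
  have hys : Summable y := by
    refine Summable.of_norm_bounded (g := fun k => (1 / 2 : ℝ) ^ k) summable_geometric_two
      fun k => (hyn k).le
  have hle : ∀ k, y k ≤ ∑' k, y k := fun k => hys.le_tsum k fun j _ => hy0 j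
  have h2 : ∀ k : ℕ, (2 : ℝ) ^ k ≤ ‖φ (∑' k, y k)‖ := fun k => by
    have h3 : ‖φ (y k)‖ ≤ ‖φ (∑' k, y k)‖ := DualLattice.norm_mono (hφ _ (hy0 k)) (hmono (hle k))
    refine le_trans ?_ h3
    rw [map_smul, norm_smul, Real.norm_of_nonneg (hc0 k), inv_mul_eq_div,
      le_div_iff₀ (by have := hx0 k; positivity)]
    refine le_trans (le_of_eq ?_) ((hx k).le.trans (habs _))
    rw [← mul_assoc, ← mul_pow]
    norm_num
  obtain ⟨k, hk⟩ := pow_unbounded_of_one_lt ‖φ (∑' k, y k)‖ (one_lt_two (α := ℝ))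
  exact absurd (h2 k) (not_le.2 hk)

end positive

/-! ### Functoriality of the symmetric tensor power. -/

section functoriality

open SymAlgTensor

variable {n : ℕ} {X : Type u} {Y : Type v}
  [NormedAddCommGroup X] [NormedSpace ℝ X] [Lattice X] [HasSolidNorm X] [IsOrderedAddMonoid X]
  [IsOrderedModule ℝ X]
  [NormedAddCommGroup Y] [NormedSpace ℝ Y] [Lattice Y] [HasSolidNorm Y] [IsOrderedAddMonoid Y]
  [IsOrderedModule ℝ Y]

open scoped TensorProduct in
variable (n) in
/-- The map of symmetric tensors induced by a linear map. -/
def symAlgMap (α : X →L[ℝ] Y) : SymAlgTensor n X →ₗ[ℝ] SymAlgTensor n Y :=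
  LinearMap.restrict (PiTensorProduct.map fun _ : Fin n => α.toLinearMap)
    (p := Submodule.span ℝ (Set.range fun x : X => PiTensorProduct.tprod ℝ fun _ : Fin n => x))
    (q := Submodule.span ℝ (Set.range fun y : Y => PiTensorProduct.tprod ℝ fun _ : Fin n => y))
    (by
      intro u hu
      refine Submodule.span_le (p := Submodule.comap (PiTensorProduct.map fun _ : Fin n =>
        α.toLinearMap) (Submodule.span ℝ
          (Set.range fun y : Y => PiTensorProduct.tprod ℝ fun _ : Fin n => y))).2 ?_ hu
      rintro _ ⟨x, rfl⟩
      rw [SetLike.mem_coe, Submodule.mem_comap, PiTensorProduct.map_tprod]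
      exact Submodule.subset_span ⟨α x, rfl⟩)

theorem symAlgMap_diag (α : X →L[ℝ] Y) (x : X) : symAlgMap n α (diag n x) = diag n (α x) := by
  apply incl_injective
  exact PiTensorProduct.map_tprod (fun _ : Fin n => α.toLinearMap) fun _ => x

theorem lift_symAlgMap {Z : Type w} [AddCommGroup Z] [Module ℝ Z] (α : X →L[ℝ] Y)
    (T : MultilinearMap ℝ (fun _ : Fin n => Y) Z) (u : SymAlgTensor n X) :
    lift T (symAlgMap n α u) = lift (T.compLinearMap fun _ => α.toLinearMap) u := by
  induction u using SymAlgTensor.induction_on with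
  | h0 => simp
  | h1 x => rw [symAlgMap_diag, lift_diag, lift_diag]; rfl
  | h2 u v hu hv => simp only [map_add, hu, hv]
  | h3 c u hu => simp only [map_smul, hu]

/-- The order is tested on positive forms, and a positive form on `Y` pulls back along `α` to a
positive form on `X`. -/
theorem symAlgMap_mono {α : X →L[ℝ] Y} (hα : ∀ x, 0 ≤ x → 0 ≤ α x) {u v : SymAlgTensor n X}
    (h : u ≤ v) : symAlgMap n α u ≤ symAlgMap n α v := by
  intro T hT
  rw [lift_symAlgMap, lift_symAlgMap]
  exact h _ fun x hx => hT _ fun i => hα _ (hx i)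

variable [NeZero n]

/-- Applying `α` to each term of a dominating sum for `u` gives a dominating sum for the image, and
each cost `‖x‖ ^ n` grows by at most the factor `‖α‖ ^ n`. -/
theorem norm_symAlgMap_le {α : X →L[ℝ] Y} (hα : ∀ x, 0 ≤ x → 0 ≤ α x) (u : SymAlgTensor n X) :
    ‖symAlgMap n α u‖ ≤ ‖α‖ ^ n * ‖u‖ := by
  rw [SymAlgTensor.norm_def, SymAlgTensor.norm_def]
  refine isDominating.le_mul_domNorm (by positivity) fun v r h0 h1 h2 => ?_
  obtain ⟨l, l1, l2, l3⟩ := h0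
  simp only at l2 l3
  refine (isDominating.domNorm_le (v := symAlgMap n α v)
    (r := ((l.map α).map fun y => ‖y‖ ^ n).sum) ⟨l.map α, ?_, ?_, rfl⟩ ?_ ?_).trans ?_
  · intro y hy
    obtain ⟨x, hx, rfl⟩ := List.mem_map.1 hy
    exact hα x (l1 x hx)
  · simp only
    rw [l2, map_list_sum, List.map_map, List.map_map]
    congr 1
    exact List.map_congr_left fun x _ => symAlgMap_diag α x
  · rw [← map_neg]; exact symAlgMap_mono hα h1
  · exact symAlgMap_mono hα h2
  · rw [l3, List.map_map, ← List.sum_map_mul_left]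
    refine List.sum_le_sum fun x _ => ?_
    rw [← mul_pow]
    exact pow_le_pow_left₀ (norm_nonneg _) (α.le_opNorm x) n

variable (n) in
/-- The map of symmetric tensor products induced by a positive linear map. -/
def symMap (α : X →L[ℝ] Y) (hα : ∀ x, 0 ≤ x → 0 ≤ α x) : SymTensor n X →L[ℝ] SymTensor n Y :=
  ((OrdCompletion.of _).comp ((symAlgMap n α).mkContinuous _ (norm_symAlgMap_le hα))).extend
    (OrdCompletion.of _)

theorem symMap_of (α : X →L[ℝ] Y) (hα : ∀ x, 0 ≤ x → 0 ≤ α x) (u : SymAlgTensor n X) :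
    symMap n α hα (OrdCompletion.of _ u) = OrdCompletion.of _ (symAlgMap n α u) :=
  ContinuousLinearMap.extend_eq _ OrdCompletion.denseRange_of OrdCompletion.isUniformInducing_of u

/-- The positive cone of the completion is the closure of the algebraic one, and its preimage is
closed. Positivity is what allows this map to be tensored with the identity of `G`. -/
theorem symMap_nonneg (α : X →L[ℝ] Y) (hα : ∀ x, 0 ≤ x → 0 ≤ α x) {z : SymTensor n X}
    (hz : 0 ≤ z) : 0 ≤ symMap n α hα z := by
  rw [OrdCompletion.nonneg_iff] at hz
  have hc : IsClosed {z : SymTensor n X | 0 ≤ symMap n α hα z} :=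
    OrdCompletion.isClosed_nonneg.preimage (symMap n α hα).continuous
  refine closure_minimal ?_ hc hz
  rintro _ ⟨u, hu, rfl⟩
  simp only [Set.mem_ofPred_eq] at hu ⊢
  rw [symMap_of, ← map_zero (OrdCompletion.of _)]
  refine OrdCompletion.of_mono ?_
  rw [← map_zero (symAlgMap n α)]
  exact symAlgMap_mono hα hu

end functoriality

/-! ### Functoriality of the positive projective tensor product in its first factor. -/

section functoriality
variable {X : Type u} {Y : Type v} {Z : Type w}
  [NormedAddCommGroup X] [NormedSpace ℝ X] [PartialOrder X] [RieszNormed X]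
  [NormedAddCommGroup Y] [NormedSpace ℝ Y] [PartialOrder Y] [RieszNormed Y]
  [NormedAddCommGroup Z] [NormedSpace ℝ Z] [PartialOrder Z] [RieszNormed Z]

variable (Z) in
/-- The linear map `x ⊗ z ↦ β x ⊗ z`. -/
def algMap (β : X →L[ℝ] Y) : AlgTensor X Z →ₗ[ℝ] AlgTensor Y Z :=
  TensorProduct.map β.toLinearMap LinearMap.id

theorem algMap_tmul (β : X →L[ℝ] Y) (x : X) (z : Z) :
    algMap Z β (AlgTensor.tmul x z) = AlgTensor.tmul (β x) z := rfl

theorem lift_algMap (β : X →L[ℝ] Y) (b : Y →ₗ[ℝ] Z →ₗ[ℝ] ℝ) (u : AlgTensor X Z) :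
    AlgTensor.lift b (algMap Z β u) = AlgTensor.lift (b ∘ₗ β.toLinearMap) u := by
  induction u using AlgTensor.induction_on with
  | h0 => simp
  | h1 x z => rw [algMap_tmul, AlgTensor.lift_tmul, AlgTensor.lift_tmul]; rfl
  | h2 u v hu hv => simp only [map_add, hu, hv]

theorem algMap_mono {β : X →L[ℝ] Y} (hβ : ∀ x, 0 ≤ x → 0 ≤ β x) {u v : AlgTensor X Z}
    (h : u ≤ v) : algMap Z β u ≤ algMap Z β v := by
  intro b hb
  rw [lift_algMap, lift_algMap]
  exact h _ fun x z hx hz => hb _ _ (hβ x hx) hz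

/-- As for symmetric tensors, `β` carries dominating sums to dominating sums and multiplies the cost
by at most `‖β‖`. -/
theorem norm_algMap_le {β : X →L[ℝ] Y} (hβ : ∀ x, 0 ≤ x → 0 ≤ β x) (u : AlgTensor X Z) :
    ‖algMap Z β u‖ ≤ ‖β‖ * ‖u‖ := by
  rw [AlgTensor.norm_def, AlgTensor.norm_def]
  refine AlgTensor.isDominating.le_mul_domNorm (norm_nonneg _) fun v r h0 h1 h2 => ?_
  obtain ⟨l, l1, l2, l3⟩ := h0
  simp only at l2 l3
  refine (AlgTensor.isDominating.domNorm_le (v := algMap Z β v)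
    (r := ((l.map fun q => (β q.1, q.2)).map fun q => ‖q.1‖ * ‖q.2‖).sum)
    ⟨l.map fun q => (β q.1, q.2), ?_, ?_, rfl⟩ ?_ ?_).trans ?_
  · intro y hy
    obtain ⟨q, hq, rfl⟩ := List.mem_map.1 hy
    exact ⟨hβ _ (l1 q hq).1, (l1 q hq).2⟩
  · simp only
    rw [l2, map_list_sum, List.map_map, List.map_map]
    rfl
  · rw [← map_neg]; exact algMap_mono hβ h1
  · exact algMap_mono hβ h2
  · rw [l3, List.map_map, ← List.sum_map_mul_left]
    refine List.sum_le_sum fun q _ => ?_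
    rw [← mul_assoc]
    exact mul_le_mul_of_nonneg_right (β.le_opNorm q.1) (norm_nonneg _)

variable (Z) in
/-- The map of positive projective tensor products induced by a positive linear map. -/
def posMap (β : X →L[ℝ] Y) (hβ : ∀ x, 0 ≤ x → 0 ≤ β x) : PosTensor X Z →L[ℝ] PosTensor Y Z :=
  ((OrdCompletion.of _).comp ((algMap Z β).mkContinuous _ (norm_algMap_le hβ))).extend
    (OrdCompletion.of _)

theorem posMap_of (β : X →L[ℝ] Y) (hβ : ∀ x, 0 ≤ x → 0 ≤ β x) (u : AlgTensor X Z) :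
    posMap Z β hβ (OrdCompletion.of _ u) = OrdCompletion.of _ (algMap Z β u) :=
  ContinuousLinearMap.extend_eq _ OrdCompletion.denseRange_of OrdCompletion.isUniformInducing_of u

end functoriality

/-! ### The induced map on the domain of `nuclearMap`. -/

section nuclear

open SymAlgTensor

variable {n : ℕ} [NeZero n] {X : Type u} {Y : Type v} {G : Type w}
  [NormedAddCommGroup X] [NormedSpace ℝ X] [Lattice X] [HasSolidNorm X] [IsOrderedAddMonoid X]
  [IsOrderedModule ℝ X]
  [NormedAddCommGroup Y] [NormedSpace ℝ Y] [Lattice Y] [HasSolidNorm Y] [IsOrderedAddMonoid Y]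
  [IsOrderedModule ℝ Y]
  [NormedAddCommGroup G] [NormedSpace ℝ G] [Lattice G] [HasSolidNorm G] [IsOrderedAddMonoid G]
  [IsOrderedModule ℝ G]

variable (n G) in
/-- The map `(x ⊗ ⋯ ⊗ x) ⊗ y ↦ (α x ⊗ ⋯ ⊗ α x) ⊗ y` induced by a positive linear map `α`. -/
def tensorMap (α : X →L[ℝ] Y) (hα : ∀ x, 0 ≤ x → 0 ≤ α x) :
    PosTensor (SymTensor n X) G →L[ℝ] PosTensor (SymTensor n Y) G :=
  posMap G (symMap n α hα) fun _ => symMap_nonneg α hα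

theorem tensorMap_diag (α : X →L[ℝ] Y) (hα : ∀ x, 0 ≤ x → 0 ≤ α x) (x : X) (y : G) :
    tensorMap n G α hα (OrdCompletion.of _ (AlgTensor.tmul (OrdCompletion.of _ (diag n x)) y)) =
      OrdCompletion.of _ (AlgTensor.tmul (OrdCompletion.of _ (diag n (α x))) y) := by
  rw [tensorMap, posMap_of, algMap_tmul, symMap_of, symAlgMap_diag]

end nuclear

/-! ### The embedding into the bidual. -/

section bidual
variable {X : Type u} [NormedAddCommGroup X] [NormedSpace ℝ X]

variable (X) in
/-- The canonical embedding of `X` into its bidual. -/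
def bidual : X →L[ℝ] DualLattice (DualLattice X) :=
  LinearMap.mkContinuous₂ (𝕜 := ℝ) (E := X) (F := DualLattice X) (G := ℝ)
    (LinearMap.mk₂ ℝ (fun x f => f x) (fun x y f => map_add f x y)
      (fun c x f => map_smul f c x) (fun _ _ _ => rfl) (fun _ _ _ => rfl)) 1 fun x f => by
    rw [one_mul, mul_comm]
    exact f.le_norm x

@[simp] theorem bidual_apply (x : X) (f : DualLattice X) : bidual X x f = f x := rfl

/-- For a dual space no extension theorem is needed: `f x` is the value of the image of `f` at the
image of `x`, whose norm is at most `‖x‖`. -/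
theorem norm_le_norm_bidual (f : DualLattice X) : ‖f‖ ≤ ‖bidual (DualLattice X) f‖ := by
  refine f.norm_le (norm_nonneg _) fun x => ?_
  have h1 := (bidual (DualLattice X) f).le_norm (bidual X x)
  have h2 : ‖bidual X x‖ ≤ ‖x‖ := (bidual X x).norm_le (norm_nonneg _) fun g => by
    rw [mul_comm]; exact g.le_norm x
  exact h1.trans (mul_le_mul_of_nonneg_left h2 (norm_nonneg _))

/-- `X*` is complete and its embedding into `X***` is bounded below. Closedness lets the property of
coming from `X*` pass from elementary tensors to their limits. -/
theorem isClosed_range_bidual :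
    IsClosed (LinearMap.range (bidual (DualLattice X)).toLinearMap :
      Set (DualLattice (DualLattice (DualLattice X)))) := by
  have h : AntilipschitzWith 1 (bidual (DualLattice X)) :=
    AddMonoidHomClass.antilipschitz_of_bound _ fun f => by
      simpa using norm_le_norm_bidual f
  exact h.isClosed_range (bidual (DualLattice X)).uniformContinuous

end bidual

/-! ### Positive extension of the multilinear map of a tensor to the bidual. -/

section nuclear

open SymAlgTensor

variable {n : ℕ} [NeZero n] {E : Type u} {F : Type v} {G : Type w}
  [NormedAddCommGroup E] [NormedSpace ℝ E] [Lattice E] [HasSolidNorm E] [IsOrderedAddMonoid E]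
  [IsOrderedModule ℝ E]
  [NormedAddCommGroup F] [NormedSpace ℝ F] [Lattice F] [HasSolidNorm F] [IsOrderedAddMonoid F]
  [IsOrderedModule ℝ F]
  [NormedAddCommGroup G] [NormedSpace ℝ G] [Lattice G] [HasSolidNorm G] [IsOrderedAddMonoid G]
  [IsOrderedModule ℝ G] [CompleteSpace G]

theorem bidual_nonneg (x : E) (hx : 0 ≤ x) : 0 ≤ bidual E x := fun _ hf => hf x hx

theorem norm_evalTensor_le (m : Fin n → E) (w : PosTensor (SymTensor n (DualLattice E)) G) :
    ‖evalTensor m w‖ ≤ (∏ i, ‖m i‖) * ‖w‖ := by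
  refine OrdCompletion.denseRange_of.induction_on w
    (isClosed_le (by fun_prop) (by fun_prop)) fun u => ?_
  rw [evalTensor_of, OrdCompletion.norm_of]
  exact norm_evalAlg_le m u

/-- A closed subspace of the tensor product which contains all elements `(f ⊗ ⋯ ⊗ f) ⊗ y` is
the whole space. -/
theorem mem_of_isClosed_of_forall_diag
    {S : Submodule ℝ (PosTensor (SymTensor n (DualLattice E)) G)}
    (hS : IsClosed (S : Set (PosTensor (SymTensor n (DualLattice E)) G)))
    (h : ∀ (f : DualLattice E) (y : G),
      OrdCompletion.of _ (AlgTensor.tmul (OrdCompletion.of _ (diag n f)) y) ∈ S)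
    (w : PosTensor (SymTensor n (DualLattice E)) G) : w ∈ S := by
  have := hS
  -- Since `S` is closed, the quotient by `S` is a normed space, and `tensor_ext` applies to the
  -- quotient map.
  have e : S.mkQL = 0 := tensor_ext fun f y => by
    simpa using h f y
  have := congrArg (fun A => A w) e
  simpa using this

/-- The extension of the `n`-linear map defined by `w` to the bidual of `E`. -/
def bidualTensor (w : PosTensor (SymTensor n (DualLattice E)) G) :
    PosTensor (SymTensor n (DualLattice (DualLattice (DualLattice E)))) G :=
  tensorMap n G (bidual (DualLattice E)) bidual_nonneg w

/-- The extension to the bidual is, in each variable, evaluation at a functional on `E`. -/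
theorem exists_eval_bidualTensor (w : PosTensor (SymTensor n (DualLattice E)) G)
    (M : Fin n → DualLattice (DualLattice E)) (i : Fin n) (g : DualLattice G) :
    ∃ f : DualLattice E, ∀ N : DualLattice (DualLattice E),
      g (evalTensor (Function.update M i N) (bidualTensor w)) = N f := by
  let J := tensorMap n G (bidual (DualLattice E)) bidual_nonneg
  let B : PosTensor (SymTensor n (DualLattice E)) G →ₗ[ℝ] DualLattice (DualLattice E) →ₗ[ℝ] ℝ :=
    LinearMap.mk₂ ℝ (fun w N => g (evalTensor (Function.update M i N) (J w)))
      (fun v w N => by simp only [map_add]) (fun c w N => by simp only [map_smul])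
      (fun w N N' => by
        simp only [← nuclearMulti_apply, MultilinearMap.map_update_add, map_add])
      (fun c w N => by
        simp only [← nuclearMulti_apply, MultilinearMap.map_update_smul, map_smul])
  -- The functional of the `i`-th variable, viewed as an element of `E***` depending continuously on
  -- the tensor. The bound is that of `norm_evalTensor_le` with the factor `‖N‖` of slot `i` split
  -- off.
  let K : PosTensor (SymTensor n (DualLattice E)) G →L[ℝ]
      DualLattice (DualLattice (DualLattice E)) :=
    LinearMap.mkContinuous₂ (𝕜 := ℝ) (F := DualLattice (DualLattice E)) (G := ℝ) B
      (‖g‖ * ‖J‖ * ∏ j ∈ Finset.univ \ {i}, ‖M j‖) fun w N => by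
        have h1 := g.le_norm (evalTensor (Function.update M i N) (J w))
        have h2 := norm_evalTensor_le (Function.update M i N) (J w)
        have h3 := J.le_opNorm w
        have h4 : ∏ j, ‖Function.update M i N j‖ = ‖N‖ * ∏ j ∈ Finset.univ \ {i}, ‖M j‖ := by
          simp_rw [Function.apply_update (fun _ (a : DualLattice (DualLattice E)) => ‖a‖)]
          rw [Finset.prod_update_of_mem (Finset.mem_univ i)]
        rw [h4] at h2
        calc ‖B w N‖ ≤ ‖g‖ * ‖evalTensor (Function.update M i N) (J w)‖ := h1
          _ ≤ ‖g‖ * (‖N‖ * (∏ j ∈ Finset.univ \ {i}, ‖M j‖) * (‖J‖ * ‖w‖)) := by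
            gcongr
            exact h2.trans (by gcongr)
          _ = _ := by ring
  have hK : ∀ w N, K w N = g (evalTensor (Function.update M i N) (J w)) := fun _ _ => rfl
  -- The tensors whose functional lies in `E*` form a closed subspace, so elementary tensors
  -- suffice.
  have hmem : w ∈ (LinearMap.range (bidual (DualLattice E)).toLinearMap).comap K.toLinearMap := by
    refine mem_of_isClosed_of_forall_diag (isClosed_range_bidual.preimage K.continuous)
      (fun f y => ?_) w
    -- For `(f ⊗ ⋯ ⊗ f) ⊗ y` the functional is `N ↦ N f · ∏_{j ≠ i} M j f · g y`.
    refine ⟨((∏ j ∈ Finset.univ \ {i}, M j f) * g y) • f, ?_⟩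
    ext N
    change N _ = K _ N
    rw [hK, tensorMap_diag, evalTensor_diag]
    simp_rw [bidual_apply,
      Function.apply_update (fun _ (a : DualLattice (DualLattice E)) => a f)]
    rw [Finset.prod_update_of_mem (Finset.mem_univ i), map_smul, map_smul, smul_eq_mul,
      smul_eq_mul]
    ring
  obtain ⟨f, hf⟩ := hmem
  refine ⟨f, fun N => ?_⟩
  have := congrArg (fun k : DualLattice (DualLattice (DualLattice E)) => k N) hf
  exact this.symm

theorem evalTensor_bidualTensor_bidual (w : PosTensor (SymTensor n (DualLattice E)) G)
    (m : Fin n → E) : evalTensor (fun i => bidual E (m i)) (bidualTensor w) = evalTensor m w := by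
  have : (evalTensor fun i => bidual E (m i)).comp
      (tensorMap n G (bidual (DualLattice E)) bidual_nonneg) = evalTensor m :=
    tensor_ext fun f y => by
      rw [ContinuousLinearMap.comp_apply, tensorMap_diag, evalTensor_diag, evalTensor_diag]
      simp
  exact congrArg (fun A => A w) this

/-- If the `n`-linear map defined by `w` is positive, so is its extension to the bidual. -/
theorem evalTensor_bidualTensor_nonneg {w : PosTensor (SymTensor n (DualLattice E)) G}
    (hw : ∀ m : Fin n → E, (∀ i, 0 ≤ m i) → 0 ≤ evalTensor m w)
    {M : Fin n → DualLattice (DualLattice E)} (hM : ∀ i, 0 ≤ M i) :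
    0 ≤ evalTensor M (bidualTensor w) := by
  -- Induction on the set `s` of variables that may lie outside `E`; for `s = ∅` this is the
  -- hypothesis on `w`.
  suffices h : ∀ (s : Finset (Fin n)) (M : Fin n → DualLattice (DualLattice E)),
      (∀ i, 0 ≤ M i) → (∀ i ∉ s, ∃ m : E, 0 ≤ m ∧ M i = bidual E m) →
      0 ≤ evalTensor M (bidualTensor w) from
    h Finset.univ M hM fun i hi => absurd (Finset.mem_univ i) hi
  intro s
  induction s using Finset.induction_on with
  | empty =>
    intro M _ h
    choose m hm0 hm using fun i => h i (Finset.notMem_empty i)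
    rw [show M = fun i => bidual E (m i) from funext hm, evalTensor_bidualTensor_bidual]
    exact hw m hm0
  | insert i s _ ih =>
    intro M hM h
    refine nonneg_of_forall_dual fun g hg => ?_
    obtain ⟨f, hf⟩ := exists_eval_bidualTensor w M i g
    -- With a positive `x` of `E` in slot `i`, only the slots in `s` are unrestricted, so the
    -- induction hypothesis gives `f x ≥ 0`.
    have hf0 : 0 ≤ f := fun x hx => by
      rw [DualLattice.zero_apply, ← bidual_apply, ← hf]
      refine hg _ (ih _ (fun j => ?_) fun j hj => ?_)
      · rcases eq_or_ne j i with rfl | hji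
        · simpa using bidual_nonneg x hx
        · simpa [hji] using hM j
      · rcases eq_or_ne j i with rfl | hji
        · exact ⟨x, hx, by simp⟩
        · simpa [hji] using h j (by simp [hji, hj])
    have := hf (M i)
    rw [Function.update_eq_self] at this
    rw [this]
    exact hM i f hf0

/-! ### Transport of positivity along a positive map of the duals. -/

/-- The functional `f ↦ (α f) (m)` on `E*`. -/
def adjointAt (α : DualLattice E →L[ℝ] DualLattice F) (m : F) : DualLattice (DualLattice E) :=
  ContinuousLinearMap.comp (M₂ := DualLattice F) (bidual F m) α

theorem adjointAt_apply (α : DualLattice E →L[ℝ] DualLattice F) (m : F) (f : DualLattice E) :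
    adjointAt α m f = α f m := rfl

/-- On elementary tensors both sides are `(∏ i, (α f) (m i)) • y`. The adjoint of `α` carries points
of `F` to `E**`, not necessarily to `E`; this is why the extension to the bidual is needed. -/
theorem evalTensor_tensorMap (α : DualLattice E →L[ℝ] DualLattice F)
    (hα : ∀ f, 0 ≤ f → 0 ≤ α f) (m : Fin n → F)
    (w : PosTensor (SymTensor n (DualLattice E)) G) :
    evalTensor m (tensorMap n G α hα w) =
      evalTensor (fun i => adjointAt α (m i)) (bidualTensor w) := by
  have : (evalTensor m).comp (tensorMap n G α hα) = (evalTensor fun i => adjointAt α (m i)).comp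
      (tensorMap n G (bidual (DualLattice E)) bidual_nonneg) :=
    tensor_ext fun f y => by
      rw [ContinuousLinearMap.comp_apply, ContinuousLinearMap.comp_apply, tensorMap_diag,
        tensorMap_diag, evalTensor_diag, evalTensor_diag]
      simp [adjointAt_apply]
  exact congrArg (fun A => A w) this

theorem evalTensor_tensorMap_nonneg {α : DualLattice E →L[ℝ] DualLattice F}
    (hα : ∀ f, 0 ≤ f → 0 ≤ α f) {w : PosTensor (SymTensor n (DualLattice E)) G}
    (hw : ∀ m : Fin n → E, (∀ i, 0 ≤ m i) → 0 ≤ evalTensor m w)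
    {m : Fin n → F} (hm : ∀ i, 0 ≤ m i) : 0 ≤ evalTensor m (tensorMap n G α hα w) := by
  rw [evalTensor_tensorMap]
  exact evalTensor_bidualTensor_nonneg hw fun i f hf => hα f hf _ (hm i)

/-- A positive polynomial comes from some positive symmetric `n`-linear map. By polarization this
map is `nuclearMulti w`, which is symmetric and has the same diagonal. -/
theorem nuclearMap_nonneg_iff {w : PosTensor (SymTensor n (DualLattice E)) G} :
    0 ≤ nuclearMap n E G w ↔ ∀ m : Fin n → E, (∀ i, 0 ≤ m i) → 0 ≤ evalTensor m w := by
  constructor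
  · intro h m hm
    obtain ⟨T, h1, h2, h3⟩ := RegularPoly.le_def.1 h
    have h4 : (nuclearMulti w - T) m = 0 := by
      refine eq_zero_of_diagonal_eq_zero (fun σ x => ?_) (fun x => ?_) m
      · rw [sub_apply, sub_apply, nuclearMulti_symm, h1]
      · rw [sub_apply, nuclearMulti_apply, ← nuclearMap_apply, ← h3,
          Pi.sub_apply]
        change nuclearMap n E G w x - (nuclearMap n E G w x - 0) = 0
        rw [sub_zero, sub_self]
    rw [sub_apply, sub_eq_zero, nuclearMulti_apply] at h4
    rw [h4]
    exact h2 m hm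
  · intro h
    rw [RegularPoly.le_def]
    exact ⟨nuclearMulti w, nuclearMulti_symm w, h, fun x => sub_zero _⟩

theorem regularPoly_sub_nonneg {P Q : RegularPoly n E G} : 0 ≤ Q - P ↔ P ≤ Q := by
  rw [RegularPoly.le_def, RegularPoly.le_def]
  rw [show (⇑(Q - P) - ⇑(0 : RegularPoly n E G) : E → G) = ⇑Q - ⇑P from
    funext fun x => sub_zero _]

/-- The assumption is on the polynomial and not on `w`, so the conclusion depends only on the
`n`-linear map that `w` defines. -/
theorem nuclearMap_tensorMap_nonneg {α : DualLattice E →L[ℝ] DualLattice F}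
    (hα : ∀ f, 0 ≤ f → 0 ≤ α f) {w : PosTensor (SymTensor n (DualLattice E)) G}
    (hw : 0 ≤ nuclearMap n E G w) : 0 ≤ nuclearMap n F G (tensorMap n G α hα w) :=
  nuclearMap_nonneg_iff.2 fun _ hm =>
    evalTensor_tensorMap_nonneg hα (nuclearMap_nonneg_iff.1 hw) hm

/-! ### Descent to the spaces of nuclear polynomials. -/

theorem tensorMap_tensorMap_of_leftInverse {α : DualLattice E →L[ℝ] DualLattice F}
    (hα : ∀ f, 0 ≤ f → 0 ≤ α f) {β : DualLattice F →L[ℝ] DualLattice E}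
    (hβ : ∀ f, 0 ≤ f → 0 ≤ β f) (h : ∀ f, β (α f) = f)
    (w : PosTensor (SymTensor n (DualLattice E)) G) :
    tensorMap n G β hβ (tensorMap n G α hα w) = w := by
  have : (tensorMap n G β hβ).comp (tensorMap n G α hα) = ContinuousLinearMap.id ℝ _ :=
    tensor_ext fun f y => by
      rw [ContinuousLinearMap.comp_apply, tensorMap_diag, tensorMap_diag, h]
      rfl
  exact congrArg (fun A => A w) this

/-- `S` turns every representative of `P` into a representative of `Q` with norm at most `C` times
as large; then take the infimum. -/
theorem nuclearNorm_le_of_lift {P : NuclearPoly n E G} {Q : NuclearPoly n F G}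
    {S : PosTensor (SymTensor n (DualLattice E)) G →L[ℝ] PosTensor (SymTensor n (DualLattice F)) G}
    {C : ℝ} (hC : 0 ≤ C) (hS : ‖S‖ ≤ C)
    (h : ∀ w, nuclearMap n E G w = P → nuclearMap n F G (S w) = Q) :
    nuclearNorm Q ≤ C * nuclearNorm P := by
  have hbdd : BddBelow {r : ℝ | ∃ w, nuclearMap n F G w = Q ∧ r = ‖w‖} :=
    ⟨0, by rintro _ ⟨w, -, rfl⟩; exact norm_nonneg w⟩
  obtain ⟨w₀, hw₀⟩ := P.2
  have key : ∀ w, nuclearMap n E G w = P → nuclearNorm Q ≤ C * ‖w‖ := fun w hw =>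
    (csInf_le hbdd ⟨S w, h w hw, rfl⟩).trans (S.le_of_opNorm_le hS w)
  -- Division by `C` needs `C > 0`; for `C = 0` a single representative gives the bound.
  rcases hC.eq_or_lt with rfl | hC
  · simpa using key w₀ hw₀
  · rw [← div_le_iff₀' hC]
    refine le_csInf ⟨_, w₀, hw₀, rfl⟩ ?_
    rintro _ ⟨w, hw, rfl⟩
    rw [div_le_iff₀' hC]
    exact key w hw

/-- A lattice isomorphism `E* ≅ F*` induces a lattice isomorphism of the spaces of regular
nuclear polynomials with values in any Banach lattice. -/
theorem exists_nuclearPoly_latticeIso (n : ℕ) [NeZero n] (G : Type w)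
    [NormedAddCommGroup G] [NormedSpace ℝ G] [Lattice G] [HasSolidNorm G] [IsOrderedAddMonoid G]
    [IsOrderedModule ℝ G] [CompleteSpace G]
    (φ : DualLattice E ≃ₗ[ℝ] DualLattice F) (hφ : IsLatticeIso φ) :
    ∃ Ψ : NuclearPoly n E G ≃ₗ[ℝ] NuclearPoly n F G, IsLatticeIso Ψ ∧
      ∃ C : ℝ, ∀ P, nuclearNorm (Ψ P) ≤ C * nuclearNorm P ∧
        nuclearNorm P ≤ C * nuclearNorm (Ψ P) := by
  have hpos : ∀ f, 0 ≤ f → 0 ≤ φ f := fun f hf => by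
    rw [← map_zero φ]; exact (hφ _ _).2 hf
  have hpos' : ∀ f, 0 ≤ f → 0 ≤ φ.symm f := fun f hf => by
    rw [← hφ, map_zero, LinearEquiv.apply_symm_apply]; exact hf
  obtain ⟨A, hA⟩ := exists_bound_of_positive φ.toLinearMap hpos
  obtain ⟨B, hB⟩ := exists_bound_of_positive φ.symm.toLinearMap hpos'
  let α : DualLattice E →L[ℝ] DualLattice F := φ.toLinearMap.mkContinuous A hA
  let β : DualLattice F →L[ℝ] DualLattice E := φ.symm.toLinearMap.mkContinuous B hB
  let S := tensorMap n G α hpos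
  let R := tensorMap n G β hpos'
  have hRS : ∀ w, R (S w) = w :=
    tensorMap_tensorMap_of_leftInverse hpos hpos' φ.symm_apply_apply
  have hSR : ∀ w, S (R w) = w :=
    tensorMap_tensorMap_of_leftInverse hpos' hpos φ.apply_symm_apply
  -- Positivity is transported forward by `α`, and back by `β` because `R` undoes `S`.
  have hS : ∀ w, 0 ≤ nuclearMap n F G (S w) ↔ 0 ≤ nuclearMap n E G w := fun w =>
    ⟨fun h => by
      have h' : 0 ≤ nuclearMap n E G (R (S w)) := nuclearMap_tensorMap_nonneg (α := β) hpos' h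
      rwa [hRS] at h',
      nuclearMap_tensorMap_nonneg (α := α) hpos⟩
  -- A polynomial is zero exactly when it and its negative are positive, so the order equivalence
  -- already identifies the kernels.
  have hS0 : ∀ w, nuclearMap n F G (S w) = 0 ↔ nuclearMap n E G w = 0 := fun w => by
    have h1 := hS w
    have h2 := hS (-w)
    rw [map_neg, map_neg, map_neg, ← zero_sub, ← zero_sub (nuclearMap n E G w),
      regularPoly_sub_nonneg, regularPoly_sub_nonneg] at h2
    rw [le_antisymm_iff, le_antisymm_iff, h1, h2]
  let e : PosTensor (SymTensor n (DualLattice E)) G ≃ₗ[ℝ]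
      PosTensor (SymTensor n (DualLattice F)) G :=
    LinearEquiv.ofLinearMap S.toLinearMap R.toLinearMap (LinearMap.ext hSR) (LinearMap.ext hRS)
  have hker : (LinearMap.ker (nuclearMap n E G)).map e.toLinearMap =
      LinearMap.ker (nuclearMap n F G) := by
    ext w
    constructor
    · rintro ⟨v, hv, rfl⟩
      exact (hS0 v).2 hv
    · intro hw
      refine ⟨R w, ?_, hSR w⟩
      have := hS0 (R w)
      rw [hSR] at this
      exact this.1 hw
  -- Each image is the quotient of the tensor product by the kernel, and `e` passes to these
  -- quotients.
  let Ψ : NuclearPoly n E G ≃ₗ[ℝ] NuclearPoly n F G :=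
    (nuclearMap n E G).quotKerEquivRange.symm ≪≫ₗ
      Submodule.Quotient.equiv _ _ e hker ≪≫ₗ (nuclearMap n F G).quotKerEquivRange
  have hΨ : ∀ (w) (P : NuclearPoly n E G), nuclearMap n E G w = P →
      nuclearMap n F G (S w) = Ψ P := fun w P hw => by
    have h1 : (nuclearMap n E G).quotKerEquivRange.symm P = Submodule.Quotient.mk w := by
      exact (LinearEquiv.symm_apply_eq _).2 (Subtype.ext hw.symm)
    change _ = (((nuclearMap n F G).quotKerEquivRange (Submodule.Quotient.equiv _ _ e hker
      ((nuclearMap n E G).quotKerEquivRange.symm P)) : NuclearPoly n F G) : RegularPoly n F G)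
    rw [h1]
    rfl
  refine ⟨Ψ, fun P Q => ?_, max ‖S‖ ‖R‖, fun P => ⟨?_, ?_⟩⟩
  · obtain ⟨v, hv⟩ := P.2
    obtain ⟨w, hw⟩ := Q.2
    change ((Ψ P : NuclearPoly n F G) : RegularPoly n F G) ≤ Ψ Q ↔
      (P : RegularPoly n E G) ≤ Q
    -- Both inequalities become positivity of the polynomial of a difference, to which `hS` applies
    -- at `w - v`.
    rw [← hΨ v P hv, ← hΨ w Q hw, ← hv, ← hw, ← regularPoly_sub_nonneg,
      ← regularPoly_sub_nonneg (P := nuclearMap n E G v), ← map_sub, ← map_sub, ← map_sub, hS]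
  · exact nuclearNorm_le_of_lift (le_max_of_le_left (norm_nonneg _)) (le_max_left _ _)
      fun w hw => hΨ w P hw
  · refine nuclearNorm_le_of_lift (S := R) (le_max_of_le_left (norm_nonneg _))
      (le_max_right _ _) fun w hw => ?_
    obtain ⟨v, hv⟩ := P.2
    -- If `w` represents `Ψ P` and `v` represents `P`, then `w - S v` is in the kernel. Hence so is
    -- its image `R w - v` under `R`, and `R w` represents `P`.
    rw [← hΨ v P hv, ← sub_eq_zero, ← map_sub] at hw
    have h1 := hS0 (R (w - S v))
    rw [hSR] at h1
    have h2 := h1.1 hw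
    rw [map_sub, map_sub, hRS, sub_eq_zero] at h2
    exact h2.trans hv

end nuclear

end RegularNuclear

end

open RegularNuclear
-- The dual `G*` is again a Banach lattice, so both assertions are instances of the same transport,
-- with the same `φ`.
theorem corollary7 {E : Type*} {F : Type*} {G : Type*}
    [NormedAddCommGroup E] [NormedSpace ℝ E] [Lattice E] [HasSolidNorm E]
    [IsOrderedAddMonoid E] [IsOrderedModule ℝ E] [CompleteSpace E]
    [NormedAddCommGroup F] [NormedSpace ℝ F] [Lattice F] [HasSolidNorm F]
    [IsOrderedAddMonoid F] [IsOrderedModule ℝ F] [CompleteSpace F]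
    [NormedAddCommGroup G] [NormedSpace ℝ G] [Lattice G] [HasSolidNorm G]
    [IsOrderedAddMonoid G] [IsOrderedModule ℝ G] [CompleteSpace G]
    (n : ℕ) [NeZero n]
    (hG : DedekindComplete G) (hLAP : HasLAP G)
    (hEF : ∃ φ : DualLattice E ≃ₗ[ℝ] DualLattice F, IsLatticeIso φ) :
    (∃ Ψ : NuclearPoly n E G ≃ₗ[ℝ] NuclearPoly n F G, IsLatticeIso Ψ ∧
      ∃ C : ℝ, ∀ P, nuclearNorm (Ψ P) ≤ C * nuclearNorm P ∧
        nuclearNorm P ≤ C * nuclearNorm (Ψ P)) ∧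
    (∃ Ψ : NuclearPoly n E (DualLattice G) ≃ₗ[ℝ] NuclearPoly n F (DualLattice G),
      IsLatticeIso Ψ ∧
      ∃ C : ℝ, ∀ P, nuclearNorm (Ψ P) ≤ C * nuclearNorm P ∧
        nuclearNorm P ≤ C * nuclearNorm (Ψ P)) := by
  obtain ⟨φ, hφ⟩ := hEF
  exact ⟨exists_nuclearPoly_latticeIso n G φ hφ,
    exists_nuclearPoly_latticeIso n (DualLattice G) φ hφ⟩
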